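/- Let $\alpha>0$ and $\tau_0>0$. Let $X:(0,1/\tau_0]\to\mathbb{R}$, $X(\tau)=P(\tau)\sin(1/\tau)$, where $P$ is a positive function of class $C^3$ on $(0,1/\tau_0]$ with $P(\tau)\sim_3\tau^\alpha$ as $\tau\to0^+$, that is, $P^{(j)}(\tau)\sim(\tau^\alpha)^{(j)}$ for $j=0,1,2,3$ (where $g\sim 0$ means that $g$ vanishes near $0$). Put $x(t)=X(1/t)$ for $t\ge\tau_0$, and let $$\Gamma=\{(x(t),\dot x(t)):t\in[\tau_0,\infty)\}\subset\mathbb{R}^2 .$$ Then there is a continuous polar angle $\varphi(t)$ of the point $(x(t),\dot x(t))\neq(0,0)$, $t\geq\tau_0$ (so that $\tan\varphi(t)=\dot x(t)/x(t)$ where $x(t)\ne0$), and for every such $\varphi$ the following holds. (i) If $\alpha\in(0,1)$, then, near the origin, $\Gamma$ is a wavy spiral $r=f(\varphi)$, $\varphi\in(-\infty,-\phi_0]$, for some $\phi_0>0$; moreover $f(\varphi)\simeq|\varphi|^{-\alpha}$ as $\varphi\to-\infty$ (each is bounded by a positive constant times the other for $\varphi$ near $-\infty$), and the phase dimension of $x$,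 i.e. the box (Minkowski) dimension of $\Gamma$, exists and equals $$\dim_{ph}(x)=\dim_B\Gamma=\frac{2}{1+\alpha}.$$ (ii) If $\alpha>1$, then $\Gamma$ is a rectifiable curve (the parametrization $t\mapsto(x(t),\dot x(t))$ has finite length on $[\tau_0,\infty)$) and, near the origin, it is a wavy spiral $r=f(\varphi)$, $\varphi\in(-\infty,-\phi_0]$, for some $\phi_0>0$. Here "near the origin, $\Gamma$ is a wavy spiral $r=f(\varphi)$, $\varphi\in(-\infty,-\phi_0]$" means that for some $t_1\ge\tau_0$ the following conditions hold. The point $(x(t),\dot x(t))$ has polar coordinates $(f(\varphi(t)),\varphi(t))$ for all $t\ge t_1$, and $\varphi$ is a strictly monotone $C^1$ map of $[t_1,\infty)$ onto $(-\infty,-\phi_0]$. The function $f:(-\infty,-\phi_0]\to(0,\infty)$ tends to $0$ at $-\infty$, and for each fixed $\varphi\le-\phi_0$ the sequence $k\mapsto f(\varphi-2k\pi)$, $k=0,1,2,\dots$, is strictly decreasing. Finally, $r(t)=f(\varphi(t))$ is a wavy function on $[t_1,\infty)$ for every exponent $\beta\in(0,1)$. A $C^1$ function $r:[s_0,\infty)\to(0,\infty)$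 with $r'(s_0)\le0$ is a wavy function with exponent $\beta\in(0,1)$ if the sequence $s_{2k+1}=\inf\{s>s_{2k}:r'(s)>0\}$, $s_{2k+2}=\inf\{s>s_{2k+1}:r(s)=r(s_{2k+1})\}$, $k=0,1,2,\dots$, is well defined (the sets are nonempty), is strictly increasing, tends to $\infty$, satisfies $s_{2k+1}-s_{2k}\ge\varepsilon$ for all $k$ with some $\varepsilon>0$, and $$\max_{[s_{2k+1},s_{2k+2}]}r-\min_{[s_{2k+1},s_{2k+2}]}r=o\left(s_{2k+1}^{-\beta-1}\right)\quad\text{as }k\to\infty .$$ -/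

import Mathlib

open Set Filter Topology MeasureTheory Asymptotics

noncomputable section

/-! ## Asymptotic comparison of real functions -/

/-- `f ≃ g` along `l`: there are positive constants `C, D` with `C f ≤ g ≤ D f` eventually. -/
def Comparable (l : Filter ℝ) (f g : ℝ → ℝ) : Prop :=
  ∃ C > 0, ∃ D > 0, ∀ᶠ t in l, C * f t ≤ g t ∧ g t ≤ D * f t

/-- `f ∼ₖ g` along `l`: the derivatives satisfy `f⁽ʲ⁾ ∼ g⁽ʲ⁾` for all `j = 0, 1, …, k`. -/
def EquivalentUpTo (k : ℕ) (l : Filter ℝ) (f g : ℝ → ℝ) : Prop :=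
  ∀ j ≤ k, IsEquivalent l (iteratedDeriv j f) (iteratedDeriv j g)

/-! ## Minkowski contents and box dimension -/

/-- Lower `s`-dimensional Minkowski content of `A ⊆ ℝᴺ`: the lower limit, as `ε → 0+`, of
`|A_ε| / ε ^ (N - s)`, with `A_ε` the open Euclidean `ε`-neighbourhood. -/
def lowerMinkowskiContent {N : ℕ} (s : ℝ) (A : Set (EuclideanSpace ℝ (Fin N))) : ENNReal :=
  liminf (fun ε : ℝ => volume (Metric.thickening ε A) / ENNReal.ofReal (ε ^ ((N : ℝ) - s)))
    (𝓝[>] (0 : ℝ))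

/-- Upper `s`-dimensional Minkowski content of `A ⊆ ℝᴺ`. -/
def upperMinkowskiContent {N : ℕ} (s : ℝ) (A : Set (EuclideanSpace ℝ (Fin N))) : ENNReal :=
  limsup (fun ε : ℝ => volume (Metric.thickening ε A) / ENNReal.ofReal (ε ^ ((N : ℝ) - s)))
    (𝓝[>] (0 : ℝ))

/-- Lower box dimension. -/
def lowerBoxDim {N : ℕ} (A : Set (EuclideanSpace ℝ (Fin N))) : ℝ :=
  sInf {s : ℝ | 0 ≤ s ∧ lowerMinkowskiContent s A = 0}

/-- Upper box dimension. -/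
def upperBoxDim {N : ℕ} (A : Set (EuclideanSpace ℝ (Fin N))) : ℝ :=
  sInf {s : ℝ | 0 ≤ s ∧ upperMinkowskiContent s A = 0}

/-- `A` is bounded, its box dimension exists, and it equals `d`. -/
def HasBoxDim {N : ℕ} (A : Set (EuclideanSpace ℝ (Fin N))) (d : ℝ) : Prop :=
  Bornology.IsBounded A ∧ lowerBoxDim A = d ∧ upperBoxDim A = d

/-! ## Phase curves -/

/-- The point `(x(t), x'(t))` of the phase plane of a function `x` on `[t₀, ∞)`; the derivative
at `t₀` is one-sided. -/
def phasePoint (x : ℝ → ℝ) (t₀ t : ℝ) : EuclideanSpace ℝ (Fin 2) :=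
  !₂[x t, derivWithin x (Ici t₀) t]

/-- The phase curve `{(x(t), x'(t)) : t ≥ t₀}`. -/
def phaseCurve (x : ℝ → ℝ) (t₀ : ℝ) : Set (EuclideanSpace ℝ (Fin 2)) :=
  phasePoint x t₀ '' Ici t₀

/-- The phase dimension of `x : [t₀, ∞) → ℝ` exists and equals `d`. -/
def HasPhaseDim (x : ℝ → ℝ) (t₀ d : ℝ) : Prop :=
  HasBoxDim (phaseCurve x t₀) d

/-- The point with polar radius `ρ` and polar angle `θ`. -/
def polarPoint (ρ θ : ℝ) : EuclideanSpace ℝ (Fin 2) :=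
  !₂[ρ * Real.cos θ, ρ * Real.sin θ]

/-- `φ` is a continuous polar angle of the phase curve of `x`; in particular
`tan φ(t) = x'(t) / x(t)` wherever `x(t) ≠ 0`. -/
def IsPhaseAngle (x : ℝ → ℝ) (t₀ : ℝ) (φ : ℝ → ℝ) : Prop :=
  ContinuousOn φ (Ici t₀) ∧
    ∀ t ∈ Ici t₀, ∃ ρ > 0, phasePoint x t₀ t = polarPoint ρ (φ t)

/-! ## Spirals and wavy spirals -/

/-- The polar graph `r = f(φ)`, `φ ≥ φ₁ > 0`, is a spiral. -/
structure IsSpiral (f : ℝ → ℝ) (φ₁ : ℝ) : Prop where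
  angle_pos : 0 < φ₁
  radius_pos : ∀ θ ∈ Ici φ₁, 0 < f θ
  tendsto_zero : Tendsto f atTop (𝓝 0)
  radially_decreasing : ∀ θ ∈ Ici φ₁, StrictAnti fun k : ℕ => f (θ + 2 * k * Real.pi)

/-- The polar graph `r = g(φ)`, `φ ≤ φ₁ < 0`, is a spiral: its mirror image `r = g(-φ)`,
`φ ≥ |φ₁|`, is a spiral. -/
def IsNegSpiral (g : ℝ → ℝ) (φ₁ : ℝ) : Prop :=
  IsSpiral (fun θ => g (-θ)) (-φ₁)

/-- Oscillation of `r` on the interval `[a, b]`. -/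
def oscOn (r : ℝ → ℝ) (a b : ℝ) : ℝ :=
  sSup (r '' Icc a b) - sInf (r '' Icc a b)

/-- `t` is the sequence with `t(0) = t₀`,
`t(2k+1) = inf {s > t(2k) : r'(s) > 0}` and `t(2k+2) = inf {s > t(2k+1) : r(s) = r(t(2k+1))}`
(all infima being infima of nonempty sets, since `∅ ⊆ ℝ` has no greatest lower bound). -/
structure IsWavySequence (r : ℝ → ℝ) (t₀ : ℝ) (t : ℕ → ℝ) : Prop where
  zero : t 0 = t₀
  odd : ∀ k : ℕ, IsGLB {s | t (2 * k) < s ∧ 0 < derivWithin r (Ici t₀) s} (t (2 * k + 1))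
  even : ∀ k : ℕ, IsGLB {s | t (2 * k + 1) < s ∧ r s = r (t (2 * k + 1))} (t (2 * k + 2))

/-- `r : [t₀, ∞) → (0, ∞)` is a wavy function, where `β` is the exponent in the decay condition
`osc r = o(t(2k+1) ^ (-β - 1))` on the intervals `[t(2k+1), t(2k+2)]`. -/
structure IsWavyFunction (β : ℝ) (r : ℝ → ℝ) (t₀ : ℝ) : Prop where
  contDiffOn : ContDiffOn ℝ 1 r (Ici t₀)
  pos : ∀ s ∈ Ici t₀, 0 < r s
  deriv_nonpos : derivWithin r (Ici t₀) t₀ ≤ 0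
  waviness : ∃ t : ℕ → ℝ, IsWavySequence r t₀ t ∧
    StrictMono t ∧ Tendsto t atTop atTop ∧
    (∃ ε > 0, ∀ k : ℕ, ε ≤ t (2 * k + 1) - t (2 * k)) ∧
    (fun k : ℕ => oscOn r (t (2 * k + 1)) (t (2 * k + 2)))
      =o[atTop] fun k : ℕ => t (2 * k + 1) ^ (-β - 1)

/-- The polar graph `r = f(φ)`, `φ ∈ (-∞, φ₁]`, `φ₁ < 0`, is a wavy spiral, and its waviness is
witnessed by the increasing or decreasing `C¹` change of variable `ψ` from `[t₀, ∞)` onto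
`(-∞, φ₁]`: the function `f ∘ ψ` is wavy. The decay exponent of a wavy function is a number in
`(0, 1)`; here every such exponent is required. -/
structure IsNegWavySpiral (f : ℝ → ℝ) (φ₁ t₀ : ℝ) (ψ : ℝ → ℝ) : Prop where
  spiral : IsNegSpiral f φ₁
  contDiffOn : ContDiffOn ℝ 1 ψ (Ici t₀)
  monotone : StrictMonoOn ψ (Ici t₀) ∨ StrictAntiOn ψ (Ici t₀)
  image_eq : ψ '' Ici t₀ = Iic φ₁
  wavy : ∀ β ∈ Ioo (0 : ℝ) 1, IsWavyFunction β (fun s => f (ψ s)) t₀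

/-- Near the origin the phase curve of `x : [τ₀, ∞) → ℝ` is the wavy spiral `r = f(φ)`,
`φ ∈ (-∞, -φ₀]`, with `φ = φ(t)` the polar angle: this holds for the part of the
curve with `t ≥ t₁`, for some `t₁ ≥ τ₀`. -/
def IsWavySpiralNearOrigin (x : ℝ → ℝ) (τ₀ : ℝ) (φ : ℝ → ℝ) (f : ℝ → ℝ) (φ₀ : ℝ) : Prop :=
  0 < φ₀ ∧ ∃ t₁ ≥ τ₀, IsNegWavySpiral f (-φ₀) t₁ φ ∧
    ∀ t ≥ t₁, phasePoint x τ₀ t = polarPoint (f (φ t)) (φ t)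

end

/-! With t = 1/τ the function becomes x(t) = p(t) sin t, where p(t) = P(1/t) behaves like t^(-α)
with three derivatives. Its phase curve is a circle slowly shrinking at rate p: the radius r is
comparable to t^(-α), and the angle φ has derivative tending to -1.

The waviness comes from the identity r r' = x'(x + x'') = (p₁ sin + p cos)(p₂ sin + 2p₁ cos). The
leading term 2 p p₁ cos² is negative of order t^(-2α-1), the rest is O(t^(-2α-2)), so r can rise
only near the zeros of cos. At t = nπ + π/2 + h the product is 2 p p₁ (a cos h - sin h)(b cos h -
sin h) with a = p₁/p and b = p₂/(2p₁). Since t(a - b) tends to (1 - α)/2, the two factors have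
distinct zeros when α ≠ 1, and r rises exactly between them (`exists_rise_interval`). There r' =
O(t^(-α-2)), hence the oscillation is o(t^(-β-1)) for every β < 1. Over any time at least 1/2 the
negative term wins (`exists_decrease_of_deriv_le`), which gives both the return after each rise and
the decrease of r over a full turn. Inverting φ yields f (`exists_wavySpiral`).

The speed of the curve is O(t^(-α)). For α > 1 this is integrable and the length is finite. For α <
1 split at T of order ε^(-1/(1+α)), where neighbouring turns are about ε apart. The arc before T has
length O(T^(1-α)) and an ε-neighbourhood of area O(ε T^(1-α)); the part after T lies in a disc of
radius comparable to T^(-α), and its ε-neighbourhood fills such a disc. Both areas have order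
ε^(2α/(1+α)), and the dimension is 2 - 2α/(1+α) = 2/(1+α). -/

/-! ### From P near 0 to an amplitude at infinity -/

/-- A positive, three times differentiable amplitude `p` on `[τ₀, ∞)` with derivatives `p₁, p₂, p₃`, behaving like
`t ^ (-α)` together with its derivatives at infinity. -/
structure IsAmplitude (α τ₀ : ℝ) (p p₁ p₂ p₃ : ℝ → ℝ) : Prop where
  exponent_pos : 0 < α
  start_pos : 0 < τ₀
  pos : ∀ t ∈ Ici τ₀, 0 < p t
  hasDeriv₀ : ∀ t ∈ Ici τ₀, HasDerivWithinAt p (p₁ t) (Ici τ₀) t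
  hasDeriv₁ : ∀ t ∈ Ici τ₀, HasDerivWithinAt p₁ (p₂ t) (Ici τ₀) t
  hasDeriv₂ : ∀ t ∈ Ici τ₀, HasDerivWithinAt p₂ (p₃ t) (Ici τ₀) t
  lim₀ : Tendsto (fun t => p t * t ^ α) atTop (𝓝 1)
  lim₁ : Tendsto (fun t => p₁ t * t ^ (α + 1)) atTop (𝓝 (-α))
  lim₂ : Tendsto (fun t => p₂ t * t ^ (α + 2)) atTop (𝓝 (α * (α + 1)))
  lim₃ : Tendsto (fun t => p₃ t * t ^ (α + 3)) atTop (𝓝 (-(α * (α + 1) * (α + 2))))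

/-- The j-th derivative of τ^α is the falling factorial of α times τ^(α-j). When that factorial is 0
(integer α < j), the equivalence still yields the limit 0, which is all that is needed. -/
theorem tendsto_iteratedDeriv_mul_rpow {α : ℝ} {P : ℝ → ℝ} {k j : ℕ} (hj : j ≤ k)
    (hP : EquivalentUpTo k (𝓝[>] 0) P (fun τ => τ ^ α)) :
    Tendsto (fun τ => iteratedDeriv j P τ * τ ^ ((j : ℝ) - α)) (𝓝[>] 0)
      (𝓝 ((descPochhammer ℝ j).eval α)) := by
  have h := (hP j hj).mul (IsEquivalent.refl (u := fun τ : ℝ => τ ^ ((j : ℝ) - α)))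
  refine h.symm.tendsto_nhds (tendsto_const_nhds.congr' ?_)
  filter_upwards [self_mem_nhdsWithin] with τ (hτ : 0 < τ)
  simp only [Pi.mul_apply]
  rw [iteratedDeriv_eq_iterate, Real.iter_deriv_rpow_const, mul_assoc, ← Real.rpow_add hτ]
  simp

theorem iteratedDerivWithin_Ioc_eq {P : ℝ → ℝ} {b τ : ℝ} (j : ℕ) (hτ : τ ∈ Ioo 0 b) :
    iteratedDerivWithin j P (Ioc 0 b) τ = iteratedDeriv j P τ := by
  rw [← iteratedDerivWithin_univ, iteratedDerivWithin, iteratedDerivWithin,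
    iteratedFDerivWithin_congr_set]
  rw [eventuallyEq_univ]
  exact Ioc_mem_nhds hτ.1 hτ.2

/-- Chain rule for t ↦ 1/t. The falling factorials recombine into rising ones, for example α(α-1) +
2α = α(α+1), so the limits for p₁, p₂, p₃ are nonzero for every α > 0, even where a derivative of
τ^α vanishes. -/
theorem exists_isAmplitude {α τ₀ : ℝ} (hα : 0 < α) (hτ₀ : 0 < τ₀) {P : ℝ → ℝ}
    (hP_smooth : ContDiffOn ℝ 3 P (Ioc 0 (1 / τ₀)))
    (hP_pos : ∀ τ ∈ Ioc 0 (1 / τ₀), 0 < P τ)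
    (hP : EquivalentUpTo 3 (𝓝[>] 0) P (fun τ => τ ^ α)) :
    ∃ p₁ p₂ p₃, IsAmplitude α τ₀ (fun t => P t⁻¹) p₁ p₂ p₃ := by
  set S := Ioc 0 (1 / τ₀) with hS
  set D := fun j : ℕ => iteratedDerivWithin j P S with hD
  have hb : 0 < 1 / τ₀ := by positivity
  have hU : UniqueDiffOn ℝ S := uniqueDiffOn_Ioc 0 (1 / τ₀)
  have hDer : ∀ j < 3, ∀ τ ∈ S, HasDerivWithinAt (D j) (D (j + 1) τ) S τ := by
    intro j hj τ hτ
    have h := hP_smooth.differentiableOn_iteratedDerivWithin (m := j) (by exact_mod_cast hj) hU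
    simp only [hD, iteratedDerivWithin_succ]
    exact (h τ hτ).hasDerivWithinAt
  have hmap : MapsTo (fun t : ℝ => t⁻¹) (Ici τ₀) S := by
    intro t (ht : τ₀ ≤ t)
    have : 0 < t := hτ₀.trans_le ht
    refine ⟨inv_pos.2 this, ?_⟩
    simpa using inv_anti₀ hτ₀ ht
  have hcomp : ∀ j < 3, ∀ t ∈ Ici τ₀,
      HasDerivWithinAt (fun t => D j t⁻¹) (-D (j + 1) t⁻¹ * (t⁻¹) ^ 2) (Ici τ₀) t := by
    intro j hj t ht
    have ht0 : t ≠ 0 := (hτ₀.trans_le ht).ne'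
    have h := (hDer j hj t⁻¹ (hmap ht)).comp t (hasDerivAt_inv ht0).hasDerivWithinAt hmap
    exact h.congr_deriv (by rw [inv_pow]; ring)
  have hinv : ∀ t ∈ Ici τ₀, HasDerivWithinAt (fun t : ℝ => t⁻¹) (-(t⁻¹) ^ 2) (Ici τ₀) t := by
    intro t ht
    have ht0 : t ≠ 0 := (hτ₀.trans_le ht).ne'
    exact (hasDerivAt_inv ht0).hasDerivWithinAt.congr_deriv (by rw [inv_pow])
  have hD0 : D 0 = P := by simp [hD]
  have hlim : ∀ j ≤ 3, Tendsto (fun t : ℝ => D j t⁻¹ * t ^ (α - j)) atTop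
      (𝓝 ((descPochhammer ℝ j).eval α)) := by
    intro j hj
    have h := (tendsto_iteratedDeriv_mul_rpow hj hP).comp tendsto_inv_atTop_nhdsGT_zero
    refine h.congr' ?_
    filter_upwards [eventually_gt_atTop τ₀] with t ht
    have ht0 : 0 < t := hτ₀.trans ht
    simp only [Function.comp, hD, hS]
    rw [iteratedDerivWithin_Ioc_eq j ⟨by positivity, by rw [one_div]; gcongr⟩,
      Real.inv_rpow ht0.le, ← Real.rpow_neg ht0.le, neg_sub]
  have hl0 := hlim 0 (by norm_num)
  have hl1 := hlim 1 (by norm_num)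
  have hl2 := hlim 2 (by norm_num)
  have hl3 := hlim 3 (by norm_num)
  have e2 : (descPochhammer ℝ 2).eval α = α * (α - 1) := by
    simp [descPochhammer_succ_right]
  have e3 : (descPochhammer ℝ 3).eval α = α * (α - 1) * (α - 2) := by
    simp [descPochhammer_succ_right]
  rw [e2] at hl2
  rw [e3] at hl3
  simp only [descPochhammer_zero, descPochhammer_one, Polynomial.eval_one, Polynomial.eval_X] at hl0 hl1
  push_cast at hl0 hl1 hl2 hl3
  have hpow : ∀ t : ℝ, 0 < t → ∀ (β : ℝ) (n : ℕ), t ^ (β - n) = t ^ β * (t⁻¹) ^ n := by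
    intro t ht β n
    rw [Real.rpow_sub_natCast ht.ne', div_eq_mul_inv, inv_pow]
  refine ⟨fun t => -D 1 t⁻¹ * (t⁻¹) ^ 2, fun t => D 2 t⁻¹ * (t⁻¹) ^ 4 + 2 * (D 1 t⁻¹ * (t⁻¹) ^ 3),
    fun t => -D 3 t⁻¹ * (t⁻¹) ^ 6 - 6 * D 2 t⁻¹ * (t⁻¹) ^ 5 - 6 * D 1 t⁻¹ * (t⁻¹) ^ 4,
    hα, hτ₀, fun t ht => hP_pos _ (hmap ht), ?_, ?_, ?_, ?_, ?_, ?_, ?_⟩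
  · intro t ht
    have := hcomp 0 (by norm_num) t ht
    rwa [hD0] at this
  · intro t ht
    have := ((hcomp 1 (by norm_num) t ht).neg).mul ((hinv t ht).pow 2)
    refine this.congr_deriv ?_
    simp only [Pi.neg_apply, Pi.pow_apply]
    push_cast
    ring
  · intro t ht
    have := ((hcomp 2 (by norm_num) t ht).mul ((hinv t ht).pow 4)).add
      (((hcomp 1 (by norm_num) t ht).mul ((hinv t ht).pow 3)).const_mul 2)
    refine this.congr_deriv ?_
    simp only [Pi.pow_apply]
    push_cast
    ring
  · rw [hD0] at hl0
    simpa using hl0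
  · refine hl1.neg.congr' ?_
    filter_upwards [eventually_gt_atTop 0] with t ht
    have h1 := hpow t ht α 1
    have h2 : t ^ (α + 1) = t ^ α * t := by rw [Real.rpow_add ht, Real.rpow_one]
    push_cast at h1
    rw [h1, h2]; field_simp
  · have := hl2.add (hl1.const_mul 2)
    rw [show α * (α - 1) + 2 * α = α * (α + 1) by ring] at this
    refine this.congr' ?_
    filter_upwards [eventually_gt_atTop 0] with t ht
    have h1 := hpow t ht α 1
    have h2 := hpow t ht α 2
    have h3 : t ^ (α + 2) = t ^ α * t ^ 2 := by rw [Real.rpow_add ht]; norm_cast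
    push_cast at h1 h2
    rw [h1, h2, h3]; field_simp
  · have := (hl3.neg.sub (hl2.const_mul 6)).sub (hl1.const_mul 6)
    rw [show -(α * (α - 1) * (α - 2)) - 6 * (α * (α - 1)) - 6 * α = -(α * (α + 1) * (α + 2)) by ring]
      at this
    refine this.congr' ?_
    filter_upwards [eventually_gt_atTop 0] with t ht
    have h1 := hpow t ht α 1
    have h2 := hpow t ht α 2
    have h3 := hpow t ht α 3
    have h4 : t ^ (α + 3) = t ^ α * t ^ 3 := by rw [Real.rpow_add ht]; norm_cast
    push_cast at h1 h2 h3
    rw [h1, h2, h3, h4]; field_simp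

/-! ### A criterion for wavy sequences -/

/-- The returns to the level r(a) in [b, c] form a nonempty compact set, so there is a least one.
Before it r cannot dip below r(a), since a dip would force an earlier return; thus r(a) is the
minimum of r up to the return. -/
theorem exists_first_return {r : ℝ → ℝ} {a b c : ℝ} (hab : a < b) (hbc : b < c)
    (hcont : ContinuousOn r (Icc a c)) (hmono : StrictMonoOn r (Icc a b)) (hdrop : r c < r a) :
    ∃ e ∈ Ioc b c, IsGLB {s | a < s ∧ r s = r a} e ∧ ∀ s ∈ Icc a e, r a ≤ r s := by
  have hgt : ∀ s ∈ Ioc a b, r a < r s := fun s hs =>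
    hmono (left_mem_Icc.2 hab.le) ⟨hs.1.le, hs.2⟩ hs.1
  set K := Icc b c ∩ r ⁻¹' {r a} with hK
  have hcont' : ContinuousOn r (Icc b c) := hcont.mono (Icc_subset_Icc_left hab.le)
  have hKcpt : IsCompact K :=
    isCompact_Icc.of_isClosed_subset (hcont'.preimage_isClosed_of_isClosed isClosed_Icc
      isClosed_singleton) inter_subset_left
  have hKne : K.Nonempty := by
    obtain ⟨s, hs, hrs⟩ := intermediate_value_Icc' hbc.le hcont'
      ⟨hdrop.le, (hgt b ⟨hab, le_rfl⟩).le⟩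
    exact ⟨s, hs, hrs⟩
  obtain ⟨e, heK, hmin⟩ := hKcpt.exists_isLeast hKne
  have hbe : b < e := by
    refine lt_of_le_of_ne heK.1.1 ?_
    rintro rfl
    exact (hgt b ⟨hab, le_rfl⟩).ne' heK.2
  have hne : ∀ s ∈ Ioo a e, r s ≠ r a := by
    intro s hs h
    rcases le_or_gt s b with h1 | h1
    · exact (hgt s ⟨hs.1, h1⟩).ne' h
    · exact absurd (hmin ⟨⟨h1.le, hs.2.le.trans heK.1.2⟩, h⟩) (not_le.2 hs.2)
  refine ⟨e, ⟨hbe, heK.1.2⟩, ?_, ?_⟩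
  · refine IsLeast.isGLB ⟨⟨hab.trans hbe, heK.2⟩, ?_⟩
    rintro s ⟨h1, h2⟩
    by_contra h
    exact hne s ⟨h1, not_le.1 h⟩ h2
  · rintro s ⟨h1, h2⟩
    rcases h1.eq_or_lt with rfl | h1
    · exact le_rfl
    rcases h2.eq_or_lt with rfl | h2
    · exact heK.2.ge
    rcases le_or_gt s b with h3 | h3
    · exact (hgt s ⟨h1, h3⟩).le
    by_contra! h4
    obtain ⟨u, hu, hru⟩ := intermediate_value_Icc' h3.le
      (hcont'.mono (Icc_subset_Icc_right (h2.le.trans heK.1.2)))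
      ⟨h4.le, (hgt b ⟨hab, le_rfl⟩).le⟩
    exact hne u ⟨hab.trans_le hu.1, hu.2.trans_lt h2⟩ hru

/-- Here r rises on (a k, b k) and has lost the gain by time c k. The first return to the level r(a
k) falls in (b k, c k], after the rise has ended, so the next time with positive derivative is
exactly the start of the next rise. The margin ε between c k and a (k + 1) gives the spacing. -/
theorem exists_isWavySequence {r r' : ℝ → ℝ} {t₀ ε : ℝ} (hε : 0 < ε) {a b c : ℕ → ℝ}
    (hder : ∀ s ∈ Ici t₀, HasDerivWithinAt r (r' s) (Ici t₀) s)
    (h0 : t₀ + ε ≤ a 0) (hab : ∀ k, a k < b k) (hbc : ∀ k, b k < c k)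
    (hca : ∀ k, c k + ε ≤ a (k + 1))
    (hpos : ∀ k, ∀ s ∈ Ioo (a k) (b k), 0 < r' s)
    (hneg₀ : ∀ s ∈ Icc t₀ (a 0), r' s ≤ 0)
    (hneg : ∀ k, ∀ s ∈ Icc (b k) (a (k + 1)), r' s ≤ 0)
    (hdrop : ∀ k, r (c k) < r (a k)) :
    ∃ t : ℕ → ℝ, IsWavySequence r t₀ t ∧ StrictMono t ∧ Tendsto t atTop atTop ∧
      (∀ k, ε ≤ t (2 * k + 1) - t (2 * k)) ∧
      ∀ k, t (2 * k + 1) = a k ∧ t (2 * k + 2) ≤ c k ∧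
        ∀ s ∈ Icc (a k) (t (2 * k + 2)), r (a k) ≤ r s := by
  have ha_step : ∀ k, a k + ε ≤ a (k + 1) := fun k => by
    linarith [hab k, hbc k, hca k]
  have ha_ge : ∀ k, t₀ + (k + 1) * ε ≤ a k := by
    intro k
    induction k with
    | zero => simpa using h0
    | succ k ih => push_cast; linarith [ha_step k]
  have ha_t₀ : ∀ k, t₀ < a k := fun k => by
    have : 0 < ((k : ℝ) + 1) * ε := by positivity
    linarith [ha_ge k]
  have hcont : ContinuousOn r (Ici t₀) := fun s hs => (hder s hs).continuousWithinAt
  have hmono : ∀ k, StrictMonoOn r (Icc (a k) (b k)) := by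
    intro k
    refine strictMonoOn_of_deriv_pos (convex_Icc _ _)
      (hcont.mono fun s hs => (ha_t₀ k).le.trans hs.1) ?_
    intro s hs
    rw [interior_Icc] at hs
    have hs0 : t₀ < s := (ha_t₀ k).trans hs.1
    rw [((hder s hs0.le).hasDerivAt (Ici_mem_nhds hs0)).deriv]
    exact hpos k s hs
  choose e he hglb hle using fun k => exists_first_return (hab k) (hbc k)
    (hcont.mono fun s hs => (ha_t₀ k).le.trans hs.1) (hmono k) (hdrop k)
  have hsets : ∀ s ∈ Ici t₀, derivWithin r (Ici t₀) s = r' s := fun s hs =>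
    (hder s hs).derivWithin (uniqueDiffOn_Ici t₀ s hs)
  -- Odd terms are the starts of the rises, the even term 2k + 2 is the k-th return, and the term 0
  -- is t₀; hence the shift by one in the even case.
  set t : ℕ → ℝ := fun n => if n % 2 = 1 then a (n / 2) else Nat.casesOn (n / 2) t₀ e with ht
  have t_odd : ∀ k, t (2 * k + 1) = a k := fun k => by
    simp only [ht, show (2 * k + 1) % 2 = 1 by omega, show (2 * k + 1) / 2 = k by omega, if_true]
  have t_zero : t 0 = t₀ := by simp [ht]
  have t_even : ∀ k, t (2 * k + 2) = e k := fun k => by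
    simp only [ht, show (2 * k + 2) % 2 = 0 by omega, show (2 * k + 2) / 2 = k + 1 by omega]
    simp
  have hgap : ∀ k, ε ≤ t (2 * k + 1) - t (2 * k) := by
    intro k
    rw [t_odd]
    cases k with
    | zero => rw [mul_zero, t_zero]; linarith
    | succ k =>
      rw [show 2 * (k + 1) = 2 * k + 2 by ring, t_even]
      linarith [(he k).2, hca k]
  have hgap' : ∀ k, t (2 * k + 1) < t (2 * k + 2) := by
    intro k
    rw [t_odd, t_even]
    exact (hab k).trans (he k).1
  have hsm : StrictMono t := by
    refine strictMono_nat_of_lt_succ fun n => ?_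
    rcases Nat.even_or_odd' n with ⟨k, rfl | rfl⟩
    · linarith [hgap k]
    · exact hgap' k
  refine ⟨t, ⟨t_zero, ?_, ?_⟩, hsm, ?_, hgap, ?_⟩
  · intro k
    have hlow : ∀ s, t (2 * k) < s → s ≤ a k → r' s ≤ 0 := by
      intro s h1 h2
      cases k with
      | zero => exact hneg₀ s ⟨by rw [mul_zero, t_zero] at h1; exact h1.le, h2⟩
      | succ k =>
        rw [show 2 * (k + 1) = 2 * k + 2 by ring, t_even] at h1
        exact hneg k s ⟨((he k).1.trans h1).le, h2⟩
    have hstart : t₀ ≤ t (2 * k) := t_zero ▸ hsm.monotone (Nat.zero_le _)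
    have hlt : t (2 * k) < a k := t_odd k ▸ hsm (Nat.lt_succ_self _)
    rw [t_odd]
    constructor
    · rintro s ⟨h1, h2⟩
      rw [hsets s (hstart.trans h1.le)] at h2
      by_contra h
      exact absurd (hlow s h1 (not_le.1 h).le) (not_le.2 h2)
    -- The derivative is positive immediately to the right of a k, so no lower bound exceeds a k.
    · intro u hu
      by_contra! h
      obtain ⟨s, hs1, hs2⟩ := exists_between (lt_min h (hab k))
      have hs3 : a k < s := hs1
      have hmem := hu (a := s) ⟨hlt.trans hs3, by
        rw [hsets s ((ha_t₀ k).trans hs3).le]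
        exact hpos k s ⟨hs3, hs2.trans_le (min_le_right _ _)⟩⟩
      exact absurd hmem (not_le.2 (hs2.trans_le (min_le_left _ _)))
  · intro k
    rw [t_odd, t_even]
    exact hglb k
  · refine tendsto_atTop_mono' (f₁ := fun n : ℕ => t₀ + (n : ℝ) * (ε / 2)) _ ?_ ?_
    · refine Eventually.of_forall fun n => ?_
      rcases Nat.even_or_odd' n with ⟨k, rfl | rfl⟩
      · cases k with
        | zero => simp [t_zero]
        | succ k =>
          have := hgap' k
          rw [t_odd] at this
          rw [show 2 * (k + 1) = 2 * k + 2 by ring]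
          push_cast
          linarith [ha_ge k]
      · rw [t_odd]
        push_cast
        linarith [ha_ge k]
    · exact tendsto_atTop_add_const_left _ _
        (tendsto_natCast_atTop_atTop.atTop_mul_const (by positivity))
  · intro k
    refine ⟨t_odd k, ?_, ?_⟩
    · rw [t_even]; exact (he k).2
    · rw [t_even]; exact hle k

/-! ### Size and derivative of the radius -/

noncomputable section

/-- The derivative of `p(t) sin t`. -/
def phaseVelocity (p p₁ : ℝ → ℝ) (t : ℝ) : ℝ := p₁ t * Real.sin t + p t * Real.cos t

/-- The distance to the origin of the phase point of `p(t) sin t`. -/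
def phaseRadius (p p₁ : ℝ → ℝ) (t : ℝ) : ℝ :=
  √((p t * Real.sin t) ^ 2 + phaseVelocity p p₁ t ^ 2)

/-- The derivative of `phaseRadius`. -/
def phaseRadiusDeriv (p p₁ p₂ : ℝ → ℝ) (t : ℝ) : ℝ :=
  phaseVelocity p p₁ t * (p₂ t * Real.sin t + 2 * p₁ t * Real.cos t) / phaseRadius p p₁ t

end

theorem eventually_rpow_bounds {q : ℝ → ℝ} {β c lo hi : ℝ}
    (h : Tendsto (fun t => q t * t ^ β) atTop (𝓝 c)) (hlo : lo < c) (hhi : c < hi) :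
    ∀ᶠ t in atTop, lo * t ^ (-β) ≤ q t ∧ q t ≤ hi * t ^ (-β) := by
  filter_upwards [h.eventually_const_lt hlo, h.eventually_lt_const hhi, eventually_gt_atTop 0]
    with t h1 h2 ht
  have e : q t = q t * t ^ β * t ^ (-β) := by
    rw [mul_assoc, ← Real.rpow_add ht]; simp
  have := Real.rpow_nonneg ht.le (-β)
  rw [e]
  exact ⟨mul_le_mul_of_nonneg_right h1.le this, mul_le_mul_of_nonneg_right h2.le this⟩

/-- Here u, v, s, k stand for t^(-α), 1/t, sin t, cos t. The quantity bounded is what remains of r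
r' after removing 2 p p₁ cos²; it is smaller than the coefficient 2 p p₁ by a factor of order 1/t.
-/
theorem abs_velocity_remainder_le {α q q₁ q₂ s k u v : ℝ} (hα : 0 < α) (hu : 0 < u) (hv0 : 0 < v)
    (hv1 : v ≤ 1) (hp : 0 < q) (h2 : q ≤ 5 / 4 * u) (hp₁ : |q₁| ≤ 2 * α * (u * v))
    (h5 : |q₂| ≤ 2 * α * (α + 1) * (u * v ^ 2)) (hsc : |s * k| ≤ 1) (hs2 : s ^ 2 ≤ 1) :
    |(q * q₂ + 2 * q₁ ^ 2) * (s * k) + q₁ * q₂ * s ^ 2| ≤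
      (5 / 2 * α * (α + 1) + 8 * α ^ 2 + 4 * α ^ 2 * (α + 1)) * (u ^ 2 * v ^ 2) := by
  have b1 : |q * q₂| ≤ 5 / 2 * α * (α + 1) * (u ^ 2 * v ^ 2) := by
    rw [abs_mul, abs_of_pos hp]
    calc q * |q₂| ≤ (5 / 4 * u) * (2 * α * (α + 1) * (u * v ^ 2)) := by gcongr
      _ = _ := by ring
  have b2 : q₁ ^ 2 ≤ 4 * α ^ 2 * (u ^ 2 * v ^ 2) := by
    rw [← sq_abs]
    calc |q₁| ^ 2 ≤ (2 * α * (u * v)) ^ 2 := by gcongr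
      _ = _ := by ring
  have b3 : |q₁ * q₂| ≤ 4 * α ^ 2 * (α + 1) * (u ^ 2 * v ^ 2) := by
    rw [abs_mul]
    calc |q₁| * |q₂| ≤ (2 * α * (u * v)) * (2 * α * (α + 1) * (u * v ^ 2)) := by gcongr
      _ = 4 * α ^ 2 * (α + 1) * (u ^ 2 * v ^ 2) * v := by ring
      _ ≤ 4 * α ^ 2 * (α + 1) * (u ^ 2 * v ^ 2) * 1 := by gcongr
      _ = _ := by ring
  have c1 : |(q * q₂ + 2 * q₁ ^ 2) * (s * k)| ≤
      5 / 2 * α * (α + 1) * (u ^ 2 * v ^ 2) + 2 * (4 * α ^ 2 * (u ^ 2 * v ^ 2)) := by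
    rw [abs_mul]
    refine (mul_le_of_le_one_right (abs_nonneg _) hsc).trans ((abs_add_le _ _).trans ?_)
    rw [abs_of_nonneg (a := 2 * q₁ ^ 2) (by positivity)]
    linarith
  have c2 : |q₁ * q₂ * s ^ 2| ≤ 4 * α ^ 2 * (α + 1) * (u ^ 2 * v ^ 2) := by
    rw [abs_mul, abs_of_nonneg (sq_nonneg s)]
    exact (mul_le_of_le_one_right (abs_nonneg _) hs2).trans b3
  refine (abs_add_le _ _).trans ((add_le_add c1 c2).trans (le_of_eq ?_))
  ring

/-- Division of r r' by r. For the negative main term the bound r ≤ 2u is the relevant one and gives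
3α/8; for the remainder it is r ≥ u/2. The constant 2(5α + K) is chosen to serve in both
conclusions. -/
theorem radial_quotient_bounds {α K q q₁ R k u v ρ ρ' : ℝ} (hα : 0 < α) (hK0 : 0 < K) (hu : 0 < u)
    (hv0 : 0 < v) (hv1 : v ≤ 1) (h1 : 3 / 4 * u ≤ q) (h2 : q ≤ 5 / 4 * u)
    (hp₁ : |q₁| ≤ 2 * α * (u * v)) (h4 : q₁ ≤ -(α / 2) * (u * v)) (hk2 : k ^ 2 ≤ 1)
    (h6 : u / 2 ≤ ρ) (h7 : ρ ≤ 2 * u) (bR : |R| ≤ K * (u ^ 2 * v ^ 2))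
    (hexp : ρ * ρ' = 2 * (q * q₁) * k ^ 2 + R) :
    ρ' ≤ u * v * (-(3 * α / 8) * k ^ 2 + 2 * (5 * α + K) * v) ∧
      |ρ'| ≤ 2 * (5 * α + K) * (u * v) := by
  have hp : 0 < q := by linarith
  have hr : 0 < ρ := by linarith
  have hpp : q * q₁ ≤ -(3 * α / 8) * (u ^ 2 * v) := by
    calc q * q₁ ≤ q * (-(α / 2) * (u * v)) := by gcongr
      _ = -(q * (α / 2 * (u * v))) := by ring
      _ ≤ -(3 / 4 * u * (α / 2 * (u * v))) := by gcongr
      _ = _ := by ring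
  have hpp' : |q * q₁| ≤ 5 / 2 * α * (u ^ 2 * v) := by
    rw [abs_mul, abs_of_pos hp]
    calc q * |q₁| ≤ (5 / 4 * u) * (2 * α * (u * v)) := by gcongr
      _ = _ := by ring
  have hρ : ρ' = (ρ * ρ') / ρ := by field_simp
  constructor
  · rw [hρ, div_le_iff₀ hr]
    have : u * v * (-(3 * α / 8) * k ^ 2 + 2 * (5 * α + K) * v) * ρ =
        -(3 * α / 8 * (u * v) * k ^ 2 * ρ) + 2 * (5 * α + K) * u * v ^ 2 * ρ := by
      ring
    rw [this, hexp]
    have d1 : 3 * α / 8 * (u * v) * k ^ 2 * ρ ≤ 3 * α / 8 * (u * v) * k ^ 2 * (2 * u) := by gcongr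
    have d2 : 2 * (5 * α + K) * u * v ^ 2 * (u / 2) ≤ 2 * (5 * α + K) * u * v ^ 2 * ρ := by gcongr
    have d3 : q * q₁ * k ^ 2 ≤ -(3 * α / 8) * (u ^ 2 * v) * k ^ 2 := by gcongr
    have d4 : R ≤ K * (u ^ 2 * v ^ 2) := (le_abs_self _).trans bR
    have d5 : 0 ≤ 5 * α * (u ^ 2 * v ^ 2) := by positivity
    linarith
  · rw [hρ, abs_div, abs_of_pos hr, div_le_iff₀ hr, hexp]
    have d1 : |2 * (q * q₁) * k ^ 2 + R| ≤ 5 * α * (u ^ 2 * v) + K * (u ^ 2 * v) := by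
      refine (abs_add_le _ _).trans (add_le_add ?_ (bR.trans ?_))
      · rw [abs_mul, abs_mul, abs_two, abs_of_nonneg (sq_nonneg k)]
        refine (mul_le_of_le_one_right (by positivity) hk2).trans ?_
        linarith
      · have : v ^ 2 ≤ v := by nlinarith
        exact mul_le_mul_of_nonneg_left (mul_le_mul_of_nonneg_left this (by positivity)) hK0.le
    have d2 : 2 * (5 * α + K) * (u * v) * (u / 2) ≤ 2 * (5 * α + K) * (u * v) * ρ := by gcongr
    linarith

namespace IsAmplitude

variable {α τ₀ : ℝ} {p p₁ p₂ p₃ : ℝ → ℝ}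

theorem eventually_bounds (H : IsAmplitude α τ₀ p p₁ p₂ p₃) :
    ∀ᶠ t in atTop, 3 / 4 * t ^ (-α) ≤ p t ∧ p t ≤ 5 / 4 * t ^ (-α) ∧
      -(2 * α) * (t ^ (-α) / t) ≤ p₁ t ∧ p₁ t ≤ -(α / 2) * (t ^ (-α) / t) ∧
      |p₂ t| ≤ 2 * α * (α + 1) * (t ^ (-α) / t ^ 2) := by
  have hα := H.exponent_pos
  have hα2 : 0 < α * (α + 1) := by positivity
  filter_upwards [eventually_rpow_bounds H.lim₀ (lo := 3 / 4) (hi := 5 / 4) (by norm_num) (by norm_num),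
    eventually_rpow_bounds H.lim₁ (lo := -(2 * α)) (hi := -(α / 2)) (by linarith) (by linarith),
    eventually_rpow_bounds H.lim₂ (lo := 0) (hi := 2 * α * (α + 1)) hα2 (by nlinarith),
    eventually_gt_atTop 0] with t h0 h1 h2 ht
  have e1 : t ^ (-(α + 1)) = t ^ (-α) / t := by
    rw [neg_add, ← sub_eq_add_neg, Real.rpow_sub ht, Real.rpow_one]
  have e2 : t ^ (-(α + 2)) = t ^ (-α) / t ^ 2 := by
    rw [neg_add, ← sub_eq_add_neg, Real.rpow_sub ht]; norm_cast
  rw [e1] at h1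
  rw [e2, zero_mul] at h2
  exact ⟨h0.1, h0.2, h1.1, h1.2, abs_le.2 ⟨by linarith [h2.1, h2.1.trans h2.2], h2.2⟩⟩

theorem continuousOn (H : IsAmplitude α τ₀ p p₁ p₂ p₃) : ContinuousOn p (Ici τ₀) :=
  fun t ht => (H.hasDeriv₀ t ht).continuousWithinAt

theorem continuousOn₁ (H : IsAmplitude α τ₀ p p₁ p₂ p₃) : ContinuousOn p₁ (Ici τ₀) :=
  fun t ht => (H.hasDeriv₁ t ht).continuousWithinAt

theorem continuousOn₂ (H : IsAmplitude α τ₀ p p₁ p₂ p₃) : ContinuousOn p₂ (Ici τ₀) :=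
  fun t ht => (H.hasDeriv₂ t ht).continuousWithinAt

/-- The curve avoids the origin from the very start τ₀: where sin t = 0, the velocity is ±p(t). -/
theorem sq_add_sq_pos (H : IsAmplitude α τ₀ p p₁ p₂ p₃) {t : ℝ} (ht : t ∈ Ici τ₀) :
    0 < (p t * Real.sin t) ^ 2 + phaseVelocity p p₁ t ^ 2 := by
  have hp := H.pos t ht
  rcases eq_or_ne (Real.sin t) 0 with h | h
  · have hc : Real.cos t ≠ 0 := fun hc => by
      have := Real.sin_sq_add_cos_sq t
      rw [h, hc] at this
      norm_num at this
    have : phaseVelocity p p₁ t ≠ 0 := by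
      simp only [phaseVelocity, h, mul_zero, zero_add]
      exact mul_ne_zero hp.ne' hc
    positivity
  · have : p t * Real.sin t ≠ 0 := mul_ne_zero hp.ne' h
    positivity

theorem phaseRadius_pos (H : IsAmplitude α τ₀ p p₁ p₂ p₃) {t : ℝ} (ht : t ∈ Ici τ₀) :
    0 < phaseRadius p p₁ t :=
  Real.sqrt_pos.2 (H.sq_add_sq_pos ht)

theorem hasDerivWithinAt_mul_sin (H : IsAmplitude α τ₀ p p₁ p₂ p₃) {t : ℝ} (ht : t ∈ Ici τ₀) :
    HasDerivWithinAt (fun t => p t * Real.sin t) (phaseVelocity p p₁ t) (Ici τ₀) t :=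
  (H.hasDeriv₀ t ht).mul (Real.hasDerivAt_sin t).hasDerivWithinAt

theorem hasDerivWithinAt_phaseVelocity (H : IsAmplitude α τ₀ p p₁ p₂ p₃) {t : ℝ}
    (ht : t ∈ Ici τ₀) :
    HasDerivWithinAt (phaseVelocity p p₁)
      (p₂ t * Real.sin t + 2 * p₁ t * Real.cos t - p t * Real.sin t) (Ici τ₀) t := by
  refine (((H.hasDeriv₁ t ht).mul (Real.hasDerivAt_sin t).hasDerivWithinAt).add
    ((H.hasDeriv₀ t ht).mul (Real.hasDerivAt_cos t).hasDerivWithinAt)).congr_deriv ?_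
  ring

theorem hasDerivWithinAt_phaseRadius (H : IsAmplitude α τ₀ p p₁ p₂ p₃) {t : ℝ} (ht : t ∈ Ici τ₀) :
    HasDerivWithinAt (phaseRadius p p₁) (phaseRadiusDeriv p p₁ p₂ t) (Ici τ₀) t := by
  have h := (((H.hasDerivWithinAt_mul_sin ht).fun_pow 2).fun_add
    ((H.hasDerivWithinAt_phaseVelocity ht).fun_pow 2)).sqrt (H.sq_add_sq_pos ht).ne'
  refine h.congr_deriv ?_
  have h0 := (H.phaseRadius_pos ht).ne'
  change _ / (2 * phaseRadius p p₁ t) = _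
  rw [phaseRadiusDeriv]
  field_simp
  push_cast
  ring

theorem phaseRadius_mul_deriv (H : IsAmplitude α τ₀ p p₁ p₂ p₃) {t : ℝ} (ht : t ∈ Ici τ₀) :
    phaseRadius p p₁ t * phaseRadiusDeriv p p₁ p₂ t =
      phaseVelocity p p₁ t * (p₂ t * Real.sin t + 2 * p₁ t * Real.cos t) := by
  rw [phaseRadiusDeriv, mul_div_cancel₀ _ (H.phaseRadius_pos ht).ne']

theorem eventually_phaseRadius_bounds (H : IsAmplitude α τ₀ p p₁ p₂ p₃) :
    ∀ᶠ t in atTop, t ^ (-α) / 2 ≤ phaseRadius p p₁ t ∧ phaseRadius p p₁ t ≤ 2 * t ^ (-α) := by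
  have hα := H.exponent_pos
  filter_upwards [H.eventually_bounds, eventually_ge_atTop (8 * α), eventually_gt_atTop 0]
    with t ⟨h1, h2, h3, h4, _⟩ h5 ht
  have hu := Real.rpow_pos_of_pos ht (-α)
  set u := t ^ (-α)
  -- The threshold t ≥ 8α makes p₁ at most a quarter of u, so that r² = p² + 2pw cos + w² with w =
  -- p₁ sin stays close to p².
  have h6 : 2 * α * (u / t) ≤ u / 4 := by
    rw [mul_div_assoc', div_le_div_iff₀ ht (by norm_num)]
    nlinarith
  have h7 : |p₁ t| ≤ u / 4 := abs_le.2 ⟨by linarith, by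
    have : 0 < α * (u / t) := by positivity
    nlinarith⟩
  have h8 : |p₁ t * Real.sin t| ≤ u / 4 := by
    rw [abs_mul]
    have := Real.abs_sin_le_one t
    nlinarith [abs_nonneg (p₁ t), abs_nonneg (Real.sin t)]
  set w := p₁ t * Real.sin t with hw
  have h9 : |w * Real.cos t| ≤ |w| := by
    rw [abs_mul]
    have := Real.abs_cos_le_one t
    nlinarith [abs_nonneg w]
  have h10 : (p t * Real.sin t) ^ 2 + phaseVelocity p p₁ t ^ 2 =
      p t ^ 2 + 2 * p t * (w * Real.cos t) + |w| ^ 2 := by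
    rw [phaseVelocity, ← hw, sq_abs]
    linear_combination p t ^ 2 * Real.sin_sq_add_cos_sq t
  have hp : 0 < p t := by linarith
  obtain ⟨h11, h12⟩ := abs_le.1 h9
  have hw0 := abs_nonneg w
  constructor
  · apply Real.le_sqrt_of_sq_le
    rw [h10]
    nlinarith
  · apply Real.sqrt_le_iff.2 ⟨by positivity, ?_⟩
    rw [h10]
    nlinarith

/-- The signed upper bound carries two facts: r decreases on average at rate t^(-α-1), and where it
rises its derivative is only O(t^(-α-2)). The absolute bound limits the loss of radius over one
turn. -/
theorem exists_phaseRadiusDeriv_bounds (H : IsAmplitude α τ₀ p p₁ p₂ p₃) :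
    ∃ c > 0, ∃ C > 0, ∀ᶠ t in atTop,
      phaseRadiusDeriv p p₁ p₂ t ≤ t ^ (-α) / t * (-c * Real.cos t ^ 2 + C / t) ∧
      |phaseRadiusDeriv p p₁ p₂ t| ≤ C * (t ^ (-α) / t) := by
  have hα := H.exponent_pos
  obtain ⟨K, hK⟩ : ∃ K, K = 5 / 2 * α * (α + 1) + 8 * α ^ 2 + 4 * α ^ 2 * (α + 1) := ⟨_, rfl⟩
  have hK0 : 0 < K := by rw [hK]; positivity
  refine ⟨3 * α / 8, by positivity, 2 * (5 * α + K), by positivity, ?_⟩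
  filter_upwards [H.eventually_bounds, H.eventually_phaseRadius_bounds, eventually_ge_atTop 1,
    eventually_ge_atTop τ₀] with t ⟨h1, h2, h3, h4, h5⟩ ⟨h6, h7⟩ ht ht₀
  have ht0 : 0 < t := by linarith
  have hu := Real.rpow_pos_of_pos ht0 (-α)
  have hr := H.phaseRadius_pos ht₀
  have hmul := H.phaseRadius_mul_deriv ht₀
  set u := t ^ (-α)
  set ρ := phaseRadius p p₁ t
  set ρ' := phaseRadiusDeriv p p₁ p₂ t
  set v := t⁻¹ with hv
  have hv0 : 0 < v := by positivity
  have hv1 : v ≤ 1 := inv_le_one_of_one_le₀ ht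
  have e1 : u / t = u * v := rfl
  have e2 : u / t ^ 2 = u * v ^ 2 := by rw [hv, inv_pow]; rfl
  rw [e1] at h3 h4 ⊢
  rw [e2] at h5
  have hp : 0 < p t := by nlinarith
  set s := Real.sin t
  set k := Real.cos t
  have hsk : s ^ 2 + k ^ 2 = 1 := Real.sin_sq_add_cos_sq t
  have hs2 : s ^ 2 ≤ 1 := by nlinarith
  have hk2 : k ^ 2 ≤ 1 := by nlinarith
  have hsc : |s * k| ≤ 1 := by
    rw [abs_le]; constructor <;> nlinarith [sq_nonneg (s + k), sq_nonneg (s - k)]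
  obtain ⟨R, hR⟩ : ∃ R, R = (p t * p₂ t + 2 * p₁ t ^ 2) * (s * k) + p₁ t * p₂ t * s ^ 2 := ⟨_, rfl⟩
  have hexp : ρ * ρ' = 2 * (p t * p₁ t) * k ^ 2 + R := by
    rw [hmul, hR, phaseVelocity]; ring
  have e3 : 2 * (5 * α + K) / t = 2 * (5 * α + K) * v := rfl
  rw [e3]
  clear_value u v ρ ρ' s k
  generalize p t = q, p₁ t = q₁, p₂ t = q₂ at *
  have hp₁ : |q₁| ≤ 2 * α * (u * v) := abs_le.2 ⟨by linarith, by
    have : 0 < α * (u * v) := by positivity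
    nlinarith⟩
  have bR : |R| ≤ K * (u ^ 2 * v ^ 2) := by
    rw [hR, hK]
    exact abs_velocity_remainder_le hα hu hv0 hv1 hp h2 hp₁ h5 hsc hs2
  exact radial_quotient_bounds hα hK0 hu hv0 hv1 h1 h2 hp₁ h4 hk2 h6 h7 bR hexp

end IsAmplitude

/-! ### Decrease of the radius over time 1/2 -/

/-- The integral of cos² over an interval of length h is at least (h - sin h)/2, so this margin
makes it at least 1/200. -/
theorem sin_le_sub_of_mem {h : ℝ} (h1 : 1 / 2 ≤ h) (h2 : h ≤ 1) : Real.sin h ≤ h - 1 / 100 := by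
  have := Real.sin_bound (x := h) (by rw [abs_le]; constructor <;> linarith)
  rw [abs_of_pos (by linarith : 0 < h)] at this
  have h3 := (abs_le.1 this).2
  have h4 : h ^ 5 ≤ h ^ 3 := pow_le_pow_of_le_one (by linarith) h2 (by norm_num)
  have h5 : (1 / 2) ^ 3 ≤ h ^ 3 := pow_le_pow_left₀ (by norm_num) h1 3
  linarith

/-- If `r'(t) ≤ t ^ (-α - 1) (-c cos² t + C / t)` for large `t`, then `r` decreases over every
interval of length at least `1/2` far enough to the right. -/
theorem exists_decrease_of_deriv_le {r r' : ℝ → ℝ} {α c C : ℝ} (hα : 0 < α) (hc : 0 < c)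
    (hC : 0 < C) (hder : ∀ᶠ t in atTop, HasDerivAt r (r' t) t)
    (hle : ∀ᶠ t in atTop, r' t ≤ t ^ (-α) / t * (-c * Real.cos t ^ 2 + C / t)) :
    ∃ T, ∀ t ≥ T, ∀ t' ≥ t + 1 / 2, r t' < r t := by
  obtain ⟨T, hT⟩ := eventually_atTop.1 (hder.and hle)
  -- For t ≥ 1 and s in [t, t + 1] one has s ≤ 2t, so the weight s^(-α-1) lies between m t^(-α-1)
  -- and t^(-α-1) and can be frozen at t.
  set m : ℝ := 2 ^ (-α - 1) with hm
  have hm0 : 0 < m := by positivity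
  -- The threshold 400C/(cm) makes C/t at most cm/400, half of the gain cm/200 coming from the
  -- integral of cos².
  have hbase : ∀ t ≥ max (max T 1) (400 * C / (c * m)), ∀ t' ∈ Icc (t + 1 / 2) (t + 1),
      r t' < r t := by
    intro t ht t' ht'
    have ht1 : 1 ≤ t := (le_max_right T 1).trans ((le_max_left _ _).trans ht)
    have htT : T ≤ t := (le_max_left T 1).trans ((le_max_left _ _).trans ht)
    have htC : 400 * C / (c * m) ≤ t := (le_max_right _ _).trans ht
    have ht0 : 0 < t := by linarith
    set w := t ^ (-α - 1) with hw
    have hw0 : 0 < w := by positivity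
    have hub : ∀ s ∈ Icc t t', r' s ≤ w * (-(c * m) * Real.cos s ^ 2 + C / t) := by
      intro s hs
      have hs0 : 0 < s := ht0.trans_le hs.1
      have e : s ^ (-α) / s = s ^ (-α - 1) := by rw [Real.rpow_sub hs0, Real.rpow_one]
      have h1 := (hT s (htT.trans hs.1)).2
      rw [e] at h1
      have h2 : s ^ (-α - 1) ≤ w := Real.rpow_le_rpow_of_nonpos ht0 hs.1 (by linarith)
      have h3 : w * m ≤ s ^ (-α - 1) := by
        rw [hw, hm, ← Real.mul_rpow ht0.le (by norm_num)]
        exact Real.rpow_le_rpow_of_nonpos hs0 (by linarith [hs.2, ht'.2]) (by linarith)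
      have h4 : C / s ≤ C / t := div_le_div_of_nonneg_left hC.le ht0 hs.1
      have h5 : 0 ≤ C / s := by positivity
      have h6 : w * m * (c * Real.cos s ^ 2) ≤ s ^ (-α - 1) * (c * Real.cos s ^ 2) :=
        mul_le_mul_of_nonneg_right h3 (by positivity)
      have h7 : s ^ (-α - 1) * (C / s) ≤ w * (C / t) := mul_le_mul h2 h4 h5 hw0.le
      linarith
    -- The function s/2 + sin s cos s / 2 is a primitive of cos²; subtracting the primitive of the
    -- upper bound from r leaves an antitone function.
    have hG : ∀ s ∈ Icc t t', HasDerivAt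
        (fun s => r s - w * (-(c * m) * (s / 2 + Real.sin s * Real.cos s / 2) + C / t * s))
        (r' s - w * (-(c * m) * Real.cos s ^ 2 + C / t)) s := by
      intro s hs
      have h1 := (hT s (htT.trans hs.1)).1
      have h2 := (((Real.hasDerivAt_sin s).mul (Real.hasDerivAt_cos s)).div_const 2)
      have h3 := ((((hasDerivAt_id s).div_const 2).add h2).const_mul (-(c * m))).add
        ((hasDerivAt_id s).const_mul (C / t))
      refine (h1.sub (h3.const_mul w)).congr_deriv ?_
      linear_combination -(w * (c * m) / 2) * Real.sin_sq_add_cos_sq s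
    have hanti := antitoneOn_of_deriv_nonpos (convex_Icc t t')
      (fun s hs => (hG s hs).continuousAt.continuousWithinAt)
      (fun s hs => (hG s (interior_subset hs)).differentiableAt.differentiableWithinAt)
      (fun s hs => by
        rw [(hG s (interior_subset hs)).deriv]
        linarith [hub s (interior_subset hs)])
    have htt : t ≤ t' := by linarith [ht'.1]
    have h1 := hanti (left_mem_Icc.2 htt) (right_mem_Icc.2 htt) htt
    simp only at h1
    have h2 : Real.sin t' * Real.cos t' - Real.sin t * Real.cos t =
        Real.sin (t' - t) * Real.cos (t' + t) := by
      rw [Real.sin_sub, Real.cos_add]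
      linear_combination (-(Real.sin t' * Real.cos t')) * Real.sin_sq_add_cos_sq t
        + (Real.sin t * Real.cos t) * Real.sin_sq_add_cos_sq t'
    have h3 := sin_le_sub_of_mem (h := t' - t) (by linarith [ht'.1]) (by linarith [ht'.2])
    have h4 : 0 ≤ Real.sin (t' - t) := Real.sin_nonneg_of_nonneg_of_le_pi (by linarith)
      (by linarith [Real.pi_gt_three, ht'.2])
    have h5 := Real.neg_one_le_cos (t' + t)
    have h6 : -Real.sin (t' - t) ≤ Real.sin (t' - t) * Real.cos (t' + t) := by nlinarith
    have h7 : C / t ≤ c * m / 400 := by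
      rw [div_le_div_iff₀ ht0 (by norm_num)]
      rw [div_le_iff₀ (by positivity)] at htC
      linarith
    have h8 : C / t * (t' - t) ≤ c * m / 400 := by
      have : 0 < C / t := by positivity
      nlinarith [ht'.1, ht'.2]
    have hcm : 0 < c * m := by positivity
    have h9 : c * m * (1 / 200) ≤
        c * m * ((t' - t) / 2 + (Real.sin t' * Real.cos t' - Real.sin t * Real.cos t) / 2) := by
      rw [h2]
      exact mul_le_mul_of_nonneg_left (by linarith) hcm.le
    have h10 : w * (-(c * m) * ((t' - t) / 2 +
        (Real.sin t' * Real.cos t' - Real.sin t * Real.cos t) / 2) + C / t * (t' - t)) < 0 :=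
      mul_neg_of_pos_of_neg hw0 (by linarith)
    linarith
  refine ⟨max (max T 1) (400 * C / (c * m)), fun t ht t' ht' => ?_⟩
  -- Longer intervals are cut into final pieces of length 1/2 and an initial one of length between
  -- 1/2 and 1.
  have key : ∀ n : ℕ, ∀ t' ∈ Icc (t + 1 / 2) (t + 1 + n / 2), r t' < r t := by
    intro n
    induction n with
    | zero => intro t' h; exact hbase t ht t' (by simpa using h)
    | succ n ih =>
      intro t' h
      rcases le_or_gt t' (t + 1) with h1 | h1
      · exact hbase t ht t' ⟨h.1, h1⟩
      · have h2 := ih (t' - 1 / 2) ⟨by linarith, by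
          have := h.2; push_cast at this; linarith⟩
        exact (hbase (t' - 1 / 2) (ht.trans (by linarith)) t' ⟨by linarith, by linarith⟩).trans h2
  obtain ⟨n, hn⟩ := exists_nat_ge (2 * (t' - t))
  exact key n t' ⟨ht', by linarith⟩

/-! ### Sign of the radial derivative: one rise in each half turn -/

/-- For |h| ≥ 1/4 the term sin h exceeds 1/5 in absolute value and dominates a cos h. For |h| ≤ 1/4
the derivative is at most 1/10 + 1/10 - (1 - 1/32) < 0. So there is a single zero, with a change of
sign from plus to minus. -/
theorem exists_zero_of_small_cot {a a' : ℝ → ℝ}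
    (ha : ∀ h ∈ Icc (-(Real.pi / 2)) (Real.pi / 2), HasDerivAt a (a' h) h)
    (hb : ∀ h ∈ Icc (-(Real.pi / 2)) (Real.pi / 2), |a h| ≤ 1 / 10)
    (hb' : ∀ h ∈ Icc (-(Real.pi / 2)) (Real.pi / 2), |a' h| ≤ 1 / 10) :
    ∃ z ∈ Ioo (-(1 / 4) : ℝ) (1 / 4), a z * Real.cos z - Real.sin z = 0 ∧
      (∀ h ∈ Ico (-(Real.pi / 2)) z, 0 < a h * Real.cos h - Real.sin h) ∧
      (∀ h ∈ Ioc z (Real.pi / 2), a h * Real.cos h - Real.sin h < 0) := by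
  have hpi := Real.pi_gt_three
  set F := fun h => a h * Real.cos h - Real.sin h with hF
  have hsub : ∀ h ∈ Icc (-(1 / 4) : ℝ) (1 / 4), h ∈ Icc (-(Real.pi / 2)) (Real.pi / 2) :=
    fun h hh => ⟨by linarith [hh.1], by linarith [hh.2]⟩
  have hsin : (1 / 5 : ℝ) < Real.sin (1 / 4) := by
    have := Real.sin_gt_sub_cube (x := 1 / 4) (by norm_num)
    norm_num at this ⊢
    linarith
  have hac : ∀ h ∈ Icc (-(Real.pi / 2)) (Real.pi / 2), |a h * Real.cos h| ≤ 1 / 10 := by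
    intro h hh
    rw [abs_mul]
    have := Real.abs_cos_le_one h
    nlinarith [hb h hh, abs_nonneg (a h), abs_nonneg (Real.cos h)]
  have hleft : ∀ h ∈ Icc (-(Real.pi / 2)) (-(1 / 4)), 0 < F h := by
    intro h hh
    have h1 := (abs_le.1 (hac h ⟨hh.1, by linarith [hh.2]⟩)).1
    have h2 : Real.sin h ≤ Real.sin (-(1 / 4)) :=
      Real.sin_le_sin_of_le_of_le_pi_div_two hh.1 (by linarith) hh.2
    rw [Real.sin_neg] at h2
    simp only [hF]; linarith
  have hright : ∀ h ∈ Icc (1 / 4) (Real.pi / 2), F h < 0 := by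
    intro h hh
    have h1 := (abs_le.1 (hac h ⟨by linarith [hh.1], hh.2⟩)).2
    have h2 : Real.sin (1 / 4) ≤ Real.sin h :=
      Real.sin_le_sin_of_le_of_le_pi_div_two (by linarith) hh.2 hh.1
    simp only [hF]; linarith
  have hder : ∀ h ∈ Icc (-(1 / 4) : ℝ) (1 / 4),
      HasDerivAt F (a' h * Real.cos h - a h * Real.sin h - Real.cos h) h := by
    intro h hh
    refine (((ha h (hsub h hh)).mul (Real.hasDerivAt_cos h)).sub
      (Real.hasDerivAt_sin h)).congr_deriv ?_
    ring
  have hcont : ContinuousOn F (Icc (-(1 / 4) : ℝ) (1 / 4)) :=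
    fun h hh => (hder h hh).continuousAt.continuousWithinAt
  have hanti : StrictAntiOn F (Icc (-(1 / 4) : ℝ) (1 / 4)) := by
    refine strictAntiOn_of_deriv_neg (convex_Icc _ _) hcont ?_
    intro h hh
    have hh := interior_subset hh
    rw [(hder h hh).deriv]
    have h1 := Real.one_sub_sq_div_two_le_cos (x := h)
    have h2 : h ^ 2 ≤ 1 / 16 := by nlinarith [hh.1, hh.2]
    have h3 : |a' h * Real.cos h| ≤ 1 / 10 := by
      rw [abs_mul]
      have := Real.abs_cos_le_one h
      nlinarith [hb' h (hsub h hh), abs_nonneg (a' h), abs_nonneg (Real.cos h)]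
    have h4 : |a h * Real.sin h| ≤ 1 / 10 := by
      rw [abs_mul]
      have := Real.abs_sin_le_one h
      nlinarith [hb h (hsub h hh), abs_nonneg (a h), abs_nonneg (Real.sin h)]
    linarith [(abs_le.1 h3).2, (abs_le.1 h4).1]
  have hl := hleft (-(1 / 4)) ⟨by linarith, le_rfl⟩
  have hr := hright (1 / 4) ⟨le_rfl, by linarith⟩
  obtain ⟨z, hz, hFz⟩ := intermediate_value_Ioo' (by norm_num) hcont ⟨hr, hl⟩
  have hz' := Ioo_subset_Icc_self hz
  refine ⟨z, hz, hFz, ?_, ?_⟩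
  · intro h hh
    rcases le_or_gt h (-(1 / 4)) with h1 | h1
    · exact hleft h ⟨hh.1, h1⟩
    · have := hanti ⟨h1.le, hh.2.le.trans hz'.2⟩ hz' hh.2
      rwa [hFz] at this
  · intro h hh
    rcases le_or_gt (1 / 4) h with h1 | h1
    · exact hright h ⟨h1, hh.2⟩
    · have := hanti hz' ⟨hz'.1.trans hh.1.le, h1.le⟩ hh.1
      rwa [hFz] at this

/-- The product of two small perturbations of `-sin` on `[-π/2, π/2]` is negative exactly on an
open interval, provided that the perturbations are different. -/
theorem exists_interval_of_product_neg {a a' b b' : ℝ → ℝ}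
    (ha : ∀ h ∈ Icc (-(Real.pi / 2)) (Real.pi / 2), HasDerivAt a (a' h) h)
    (hb : ∀ h ∈ Icc (-(Real.pi / 2)) (Real.pi / 2), HasDerivAt b (b' h) h)
    (hsmall : ∀ h ∈ Icc (-(Real.pi / 2)) (Real.pi / 2),
      |a h| ≤ 1 / 10 ∧ |a' h| ≤ 1 / 10 ∧ |b h| ≤ 1 / 10 ∧ |b' h| ≤ 1 / 10 ∧ a h ≠ b h) :
    ∃ lo hi : ℝ, -(1 / 4) < lo ∧ lo < hi ∧ hi < 1 / 4 ∧
      (∀ h ∈ Ioo lo hi,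
        (a h * Real.cos h - Real.sin h) * (b h * Real.cos h - Real.sin h) < 0) ∧
      (∀ h ∈ Icc (-(Real.pi / 2)) lo,
        0 ≤ (a h * Real.cos h - Real.sin h) * (b h * Real.cos h - Real.sin h)) ∧
      (∀ h ∈ Icc hi (Real.pi / 2),
        0 ≤ (a h * Real.cos h - Real.sin h) * (b h * Real.cos h - Real.sin h)) := by
  have hpi := Real.pi_gt_three
  obtain ⟨y, hy, hy0, hy1, hy2⟩ := exists_zero_of_small_cot ha (fun h hh => (hsmall h hh).1)
    (fun h hh => (hsmall h hh).2.1)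
  obtain ⟨z, hz, hz0, hz1, hz2⟩ := exists_zero_of_small_cot hb (fun h hh => (hsmall h hh).2.2.1)
    (fun h hh => (hsmall h hh).2.2.2.1)
  -- At a common zero cos is positive, so a and b would agree there.
  have hne : y ≠ z := by
    rintro rfl
    have hcos : 0 < Real.cos y := Real.cos_pos_of_mem_Ioo ⟨by linarith [hy.1], by linarith [hy.2]⟩
    refine (hsmall y ⟨by linarith [hy.1], by linarith [hy.2]⟩).2.2.2.2 ?_
    exact mul_right_cancel₀ hcos.ne' (by linarith)
  have hy1' : ∀ h ∈ Icc (-(Real.pi / 2)) y, 0 ≤ a h * Real.cos h - Real.sin h := fun h hh => by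
    rcases hh.2.eq_or_lt with rfl | h1
    exacts [hy0.ge, (hy1 h ⟨hh.1, h1⟩).le]
  have hy2' : ∀ h ∈ Icc y (Real.pi / 2), a h * Real.cos h - Real.sin h ≤ 0 := fun h hh => by
    rcases hh.1.eq_or_lt with rfl | h1
    exacts [hy0.le, (hy2 h ⟨h1, hh.2⟩).le]
  have hz1' : ∀ h ∈ Icc (-(Real.pi / 2)) z, 0 ≤ b h * Real.cos h - Real.sin h := fun h hh => by
    rcases hh.2.eq_or_lt with rfl | h1
    exacts [hz0.ge, (hz1 h ⟨hh.1, h1⟩).le]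
  have hz2' : ∀ h ∈ Icc z (Real.pi / 2), b h * Real.cos h - Real.sin h ≤ 0 := fun h hh => by
    rcases hh.1.eq_or_lt with rfl | h1
    exacts [hz0.le, (hz2 h ⟨h1, hh.2⟩).le]
  have hsym : ∀ h, h ∈ Ioo (min y z) (max y z) →
      (a h * Real.cos h - Real.sin h) * (b h * Real.cos h - Real.sin h) < 0 := by
    intro h hh
    rcases lt_or_gt_of_ne hne with h1 | h1
    · rw [min_eq_left h1.le, max_eq_right h1.le] at hh
      exact mul_neg_of_neg_of_pos (hy2 h ⟨hh.1, by linarith [hh.2, hz.2]⟩)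
        (hz1 h ⟨by linarith [hh.1, hy.1], hh.2⟩)
    · rw [min_eq_right h1.le, max_eq_left h1.le] at hh
      exact mul_neg_of_pos_of_neg (hy1 h ⟨by linarith [hh.1, hz.1], hh.2⟩)
        (hz2 h ⟨hh.1, by linarith [hh.2, hy.2]⟩)
  refine ⟨min y z, max y z, lt_min hy.1 hz.1, min_lt_max.2 hne, max_lt hy.2 hz.2, hsym, ?_, ?_⟩
  · intro h hh
    exact mul_nonneg (hy1' h ⟨hh.1, hh.2.trans (min_le_left _ _)⟩)
      (hz1' h ⟨hh.1, hh.2.trans (min_le_right _ _)⟩)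
  · intro h hh
    exact mul_nonneg_of_nonpos_of_nonpos (hy2' h ⟨(le_max_left _ _).trans hh.1, hh.2⟩)
      (hz2' h ⟨(le_max_right _ _).trans hh.1, hh.2⟩)

theorem tendsto_div_mul_pow {q q' : ℝ → ℝ} {β c c' : ℝ} (n : ℕ) (hc' : c' ≠ 0)
    (h : Tendsto (fun t => q t * t ^ (β + n)) atTop (𝓝 c))
    (h' : Tendsto (fun t => q' t * t ^ β) atTop (𝓝 c')) :
    Tendsto (fun t => q t / q' t * t ^ n) atTop (𝓝 (c / c')) := by
  refine (h.div h' hc').congr' ?_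
  filter_upwards [eventually_gt_atTop 0] with t ht
  have : t ^ β ≠ 0 := (Real.rpow_pos_of_pos ht β).ne'
  simp only [Pi.div_apply]
  rw [Real.rpow_add ht, Real.rpow_natCast]
  field_simp

theorem tendsto_zero_of_mul_pow {q : ℝ → ℝ} {c : ℝ} {n : ℕ} (hn : n ≠ 0)
    (h : Tendsto (fun t => q t * t ^ n) atTop (𝓝 c)) : Tendsto q atTop (𝓝 0) := by
  have h1 := h.mul (tendsto_pow_atTop hn).inv_tendsto_atTop
  rw [mul_zero] at h1
  refine h1.congr' ?_
  filter_upwards [eventually_gt_atTop 0] with t ht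
  simp only [Pi.inv_apply]
  field_simp

namespace IsAmplitude

variable {α τ₀ : ℝ} {p p₁ p₂ p₃ : ℝ → ℝ}

theorem tendsto_logDeriv_mul (H : IsAmplitude α τ₀ p p₁ p₂ p₃) :
    Tendsto (fun t => p₁ t / p t * t ^ 1) atTop (𝓝 (-α)) := by
  have := tendsto_div_mul_pow (q := p₁) (β := α) 1 one_ne_zero (by simpa using H.lim₁) H.lim₀
  simpa using this

theorem tendsto_logDeriv (H : IsAmplitude α τ₀ p p₁ p₂ p₃) :
    Tendsto (fun t => p₁ t / p t) atTop (𝓝 0) :=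
  tendsto_zero_of_mul_pow one_ne_zero H.tendsto_logDeriv_mul

theorem tendsto_second_div (H : IsAmplitude α τ₀ p p₁ p₂ p₃) :
    Tendsto (fun t => p₂ t / p t) atTop (𝓝 0) :=
  tendsto_zero_of_mul_pow two_ne_zero
    (tendsto_div_mul_pow (q := p₂) (β := α) 2 one_ne_zero (by simpa using H.lim₂) H.lim₀)

theorem tendsto_second_logDeriv_mul (H : IsAmplitude α τ₀ p p₁ p₂ p₃) :
    Tendsto (fun t => p₂ t / p₁ t * t ^ 1) atTop (𝓝 (-(α + 1))) := by
  have hα := H.exponent_pos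
  have := tendsto_div_mul_pow (q := p₂) (β := α + 1) 1 (by linarith : -α ≠ 0)
    (by simpa [add_assoc, one_add_one_eq_two] using H.lim₂) H.lim₁
  rwa [show α * (α + 1) / -α = -(α + 1) by field_simp] at this

theorem tendsto_second_logDeriv (H : IsAmplitude α τ₀ p p₁ p₂ p₃) :
    Tendsto (fun t => p₂ t / p₁ t) atTop (𝓝 0) :=
  tendsto_zero_of_mul_pow one_ne_zero H.tendsto_second_logDeriv_mul

theorem tendsto_third_div (H : IsAmplitude α τ₀ p p₁ p₂ p₃) :
    Tendsto (fun t => p₃ t / p₁ t) atTop (𝓝 0) := by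
  have hα := H.exponent_pos
  have h := H.lim₃
  simp only [show α + 3 = α + 1 + (2 : ℕ) by push_cast; ring] at h
  exact tendsto_zero_of_mul_pow two_ne_zero
    (tendsto_div_mul_pow (q := p₃) (β := α + 1) 2 (by linarith : -α ≠ 0) h H.lim₁)

theorem hasDerivAt_logDeriv (H : IsAmplitude α τ₀ p p₁ p₂ p₃) {t : ℝ} (ht : τ₀ < t) :
    HasDerivAt (fun t => p₁ t / p t) (p₂ t / p t - (p₁ t / p t) ^ 2) t := by
  have hn := Ici_mem_nhds ht
  have hp := (H.pos t ht.le).ne'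
  refine (((H.hasDeriv₁ t ht.le).hasDerivAt hn).div ((H.hasDeriv₀ t ht.le).hasDerivAt hn)
    hp).congr_deriv ?_
  field_simp

theorem hasDerivAt_second_logDeriv (H : IsAmplitude α τ₀ p p₁ p₂ p₃) {t : ℝ} (ht : τ₀ < t)
    (hp : p₁ t ≠ 0) :
    HasDerivAt (fun t => p₂ t / p₁ t / 2) ((p₃ t / p₁ t - (p₂ t / p₁ t) ^ 2) / 2) t := by
  have hn := Ici_mem_nhds ht
  refine ((((H.hasDeriv₂ t ht.le).hasDerivAt hn).div ((H.hasDeriv₁ t ht.le).hasDerivAt hn)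
    hp).div_const 2).congr_deriv ?_
  field_simp

/-- The last claim is where waviness needs α ≠ 1: t times the difference of the two quotients tends
to -α + (α + 1)/2 = (1 - α)/2. -/
theorem eventually_logDeriv_small (H : IsAmplitude α τ₀ p p₁ p₂ p₃) (hα1 : α ≠ 1) :
    ∀ᶠ t in atTop, |p₁ t / p t| ≤ 1 / 10 ∧ |p₂ t / p t - (p₁ t / p t) ^ 2| ≤ 1 / 10 ∧
      |p₂ t / p₁ t / 2| ≤ 1 / 10 ∧ |(p₃ t / p₁ t - (p₂ t / p₁ t) ^ 2) / 2| ≤ 1 / 10 ∧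
      p₁ t / p t ≠ p₂ t / p₁ t / 2 := by
  have small : ∀ {q : ℝ → ℝ}, Tendsto q atTop (𝓝 0) → ∀ᶠ t in atTop, |q t| ≤ 1 / 10 := by
    intro q hq
    have := hq.abs
    rw [abs_zero] at this
    exact (this.eventually_lt_const (by norm_num : (0 : ℝ) < 1 / 10)).mono fun t h => h.le
  have h1 := H.tendsto_logDeriv
  have h2 := H.tendsto_second_div.sub (h1.pow 2)
  have h3 := H.tendsto_second_logDeriv.div_const 2
  have h4 := (H.tendsto_third_div.sub (H.tendsto_second_logDeriv.pow 2)).div_const 2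
  have h5 := H.tendsto_logDeriv_mul.sub (H.tendsto_second_logDeriv_mul.div_const 2)
  norm_num at h2 h3 h4
  have h6 : -α - -(α + 1) / 2 ≠ 0 := fun h => hα1 (by linarith)
  filter_upwards [small h1, small h2, small h3, small h4, h5.eventually_ne h6] with
    t g1 g2 g3 g4 g5
  refine ⟨g1, g2, g3, g4, fun h => g5 ?_⟩
  rw [h]; ring

/-- At s = nπ + π/2 + h the derivative r' equals 2 p p₁ / r times (a cos h - sin h)(b cos h - sin
h), with a = p₁/p and b = p₂/(2p₁); the signs (-1)^n cancel. The prefactor is negative, so r rises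
exactly where the product is negative, between the zeros of the two factors. -/
theorem exists_rise_interval (H : IsAmplitude α τ₀ p p₁ p₂ p₃) (hα1 : α ≠ 1) :
    ∃ T, ∀ n : ℕ, T ≤ n * Real.pi → ∃ lo hi : ℝ, -(1 / 4) < lo ∧ lo < hi ∧ hi < 1 / 4 ∧
      (∀ s ∈ Ioo (n * Real.pi + Real.pi / 2 + lo) (n * Real.pi + Real.pi / 2 + hi),
        0 < phaseRadiusDeriv p p₁ p₂ s) ∧
      (∀ s ∈ Icc (n * Real.pi) (n * Real.pi + Real.pi / 2 + lo),
        phaseRadiusDeriv p p₁ p₂ s ≤ 0) ∧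
      (∀ s ∈ Icc (n * Real.pi + Real.pi / 2 + hi) (n * Real.pi + Real.pi),
        phaseRadiusDeriv p p₁ p₂ s ≤ 0) := by
  have hα := H.exponent_pos
  obtain ⟨T, hT⟩ := eventually_atTop.1
    (((H.eventually_logDeriv_small hα1).and H.eventually_bounds).and (eventually_gt_atTop τ₀))
  refine ⟨max T 1, fun n hn => ?_⟩
  have hpi := Real.pi_gt_three
  set m := n * Real.pi + Real.pi / 2 with hm
  have hge : ∀ h ∈ Icc (-(Real.pi / 2)) (Real.pi / 2), max T 1 ≤ m + h := fun h hh => by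
    linarith [hh.1]
  have hlt : ∀ h ∈ Icc (-(Real.pi / 2)) (Real.pi / 2), τ₀ < m + h := fun h hh =>
    (hT _ ((le_max_left _ _).trans (hge h hh))).2
  have hneg : ∀ h ∈ Icc (-(Real.pi / 2)) (Real.pi / 2), p₁ (m + h) < 0 := fun h hh => by
    obtain ⟨⟨-, -, -, -, h4, -⟩, -⟩ := hT _ ((le_max_left _ _).trans (hge h hh))
    have h0 : 0 < m + h := by linarith [hge h hh, le_max_right T 1]
    have : 0 < α / 2 * ((m + h) ^ (-α) / (m + h)) := by positivity
    linarith
  obtain ⟨lo, hi, h1, h2, h3, h4, h5, h6⟩ := exists_interval_of_product_neg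
    (a := fun h => p₁ (m + h) / p (m + h)) (b := fun h => p₂ (m + h) / p₁ (m + h) / 2)
    (fun h hh => (H.hasDerivAt_logDeriv (hlt h hh)).comp_const_add m h)
    (fun h hh => (H.hasDerivAt_second_logDeriv (hlt h hh) (hneg h hh).ne).comp_const_add m h)
    (fun h hh => (hT _ ((le_max_left _ _).trans (hge h hh))).1.1)
  have hsign : ∀ h ∈ Icc (-(Real.pi / 2)) (Real.pi / 2), phaseRadiusDeriv p p₁ p₂ (m + h) =
      2 * p (m + h) * p₁ (m + h) / phaseRadius p p₁ (m + h) *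
        ((p₁ (m + h) / p (m + h) * Real.cos h - Real.sin h) *
          (p₂ (m + h) / p₁ (m + h) / 2 * Real.cos h - Real.sin h)) := by
    intro h hh
    have hp := (H.pos _ (hlt h hh).le).ne'
    have hp₁ := (hneg h hh).ne
    have e1 : Real.sin (m + h) = (-1) ^ n * Real.cos h := by
      rw [hm, show n * Real.pi + Real.pi / 2 + h = h + n * Real.pi + Real.pi / 2 by ring,
        Real.sin_add_pi_div_two, Real.cos_add_nat_mul_pi]
    have e2 : Real.cos (m + h) = -((-1) ^ n * Real.sin h) := by
      rw [hm, show n * Real.pi + Real.pi / 2 + h = h + n * Real.pi + Real.pi / 2 by ring,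
        Real.cos_add_pi_div_two, Real.sin_add_nat_mul_pi]
    have e3 : ((-1 : ℝ) ^ n) ^ 2 = 1 := by
      rw [← pow_mul, mul_comm, pow_mul]; norm_num
    rw [phaseRadiusDeriv, phaseVelocity, e1, e2, div_mul_eq_mul_div]
    congr 1
    have : 2 * p (m + h) * p₁ (m + h) * ((p₁ (m + h) / p (m + h) * Real.cos h - Real.sin h) *
          (p₂ (m + h) / p₁ (m + h) / 2 * Real.cos h - Real.sin h)) =
        (p₁ (m + h) * Real.cos h - p (m + h) * Real.sin h) *
          (p₂ (m + h) * Real.cos h - 2 * p₁ (m + h) * Real.sin h) := by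
      field_simp
    rw [this]
    linear_combination ((p₁ (m + h) * Real.cos h - p (m + h) * Real.sin h) *
          (p₂ (m + h) * Real.cos h - 2 * p₁ (m + h) * Real.sin h)) * e3
  have hfac : ∀ h ∈ Icc (-(Real.pi / 2)) (Real.pi / 2),
      2 * p (m + h) * p₁ (m + h) / phaseRadius p p₁ (m + h) < 0 := by
    intro h hh
    have hp := H.pos _ (hlt h hh).le
    exact div_neg_of_neg_of_pos (mul_neg_of_pos_of_neg (by positivity) (hneg h hh))
      (H.phaseRadius_pos (hlt h hh).le)
  refine ⟨lo, hi, h1, h2, h3, ?_, ?_, ?_⟩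
  · intro s hs
    obtain ⟨h, rfl⟩ : ∃ h, s = m + h := ⟨s - m, by ring⟩
    have hh : h ∈ Ioo lo hi := ⟨by linarith [hs.1], by linarith [hs.2]⟩
    have hh' : h ∈ Icc (-(Real.pi / 2)) (Real.pi / 2) :=
      ⟨by linarith [hh.1], by linarith [hh.2]⟩
    rw [hsign h hh']
    exact mul_pos_of_neg_of_neg (hfac h hh') (h4 h hh)
  · intro s hs
    obtain ⟨h, rfl⟩ : ∃ h, s = m + h := ⟨s - m, by ring⟩
    have hh : h ∈ Icc (-(Real.pi / 2)) lo := ⟨by linarith [hs.1], by linarith [hs.2]⟩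
    have hh' : h ∈ Icc (-(Real.pi / 2)) (Real.pi / 2) := ⟨hh.1, by linarith [hh.2]⟩
    rw [hsign h hh']
    exact mul_nonpos_of_nonpos_of_nonneg (hfac h hh').le (h5 h hh)
  · intro s hs
    obtain ⟨h, rfl⟩ : ∃ h, s = m + h := ⟨s - m, by ring⟩
    have hh : h ∈ Icc hi (Real.pi / 2) := ⟨by linarith [hs.1], by linarith [hs.2]⟩
    have hh' : h ∈ Icc (-(Real.pi / 2)) (Real.pi / 2) := ⟨by linarith [hh.1], hh.2⟩
    rw [hsign h hh']
    exact mul_nonpos_of_nonpos_of_nonneg (hfac h hh').le (h6 h hh)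

theorem hasDerivAt_phaseRadius (H : IsAmplitude α τ₀ p p₁ p₂ p₃) {t : ℝ} (ht : τ₀ < t) :
    HasDerivAt (phaseRadius p p₁) (phaseRadiusDeriv p p₁ p₂ t) t :=
  (H.hasDerivWithinAt_phaseRadius ht.le).hasDerivAt (Ici_mem_nhds ht)

theorem exists_phaseRadius_decrease (H : IsAmplitude α τ₀ p p₁ p₂ p₃) :
    ∃ T, ∀ t ≥ T, ∀ t' ≥ t + 1 / 2, phaseRadius p p₁ t' < phaseRadius p p₁ t := by
  obtain ⟨c, hc, C, hC, h⟩ := H.exists_phaseRadiusDeriv_bounds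
  exact exists_decrease_of_deriv_le H.exponent_pos hc hC
    ((eventually_gt_atTop τ₀).mono fun t ht => H.hasDerivAt_phaseRadius ht) (h.mono fun t h => h.1)

theorem contDiffOn_phaseRadius (H : IsAmplitude α τ₀ p p₁ p₂ p₃) {t₀ : ℝ} (ht₀ : τ₀ ≤ t₀) :
    ContDiffOn ℝ 1 (phaseRadius p p₁) (Ici t₀) := by
  have hder : ∀ t ∈ Ici t₀, HasDerivWithinAt (phaseRadius p p₁) (phaseRadiusDeriv p p₁ p₂ t)
      (Ici t₀) t := fun t ht =>
    (H.hasDerivWithinAt_phaseRadius (ht₀.trans ht)).mono (Ici_subset_Ici.2 ht₀)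
  rw [contDiffOn_one_iff_derivWithin (uniqueDiffOn_Ici t₀)]
  refine ⟨fun t ht => (hder t ht).differentiableWithinAt, ?_⟩
  have hsub : Ici t₀ ⊆ Ici τ₀ := Ici_subset_Ici.2 ht₀
  have c0 := H.continuousOn.mono hsub
  have c1 := H.continuousOn₁.mono hsub
  have c2 := H.continuousOn₂.mono hsub
  have cs := Real.continuous_sin.continuousOn (s := Ici t₀)
  have cc := Real.continuous_cos.continuousOn (s := Ici t₀)
  have : ContinuousOn (phaseRadiusDeriv p p₁ p₂) (Ici t₀) := by
    refine (((c1.mul cs).add (c0.mul cc)).mul ((c2.mul cs).add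
      ((continuousOn_const.mul c1).mul cc))).div
      (fun t ht => (hder t ht).continuousWithinAt)
      (fun t ht => (H.phaseRadius_pos (hsub ht)).ne')
  exact this.congr fun t ht => (hder t ht).derivWithin (uniqueDiffOn_Ici t₀ t ht)

end IsAmplitude

/-! ### The radius is a wavy function -/

/-- Only values on the half line matter, because the derivative is taken within it and the whole
sequence stays in it. This is needed since f ∘ φ agrees with the radius only there. -/
theorem IsWavyFunction.congr {β t₀ : ℝ} {r ρ : ℝ → ℝ} (h : IsWavyFunction β r t₀)
    (heq : EqOn ρ r (Ici t₀)) : IsWavyFunction β ρ t₀ := by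
  have hd : ∀ s ∈ Ici t₀, derivWithin ρ (Ici t₀) s = derivWithin r (Ici t₀) s := fun s hs =>
    derivWithin_congr heq (heq hs)
  obtain ⟨t, ht, hsm, hlim, hgap, hosc⟩ := h.waviness
  have hge : ∀ n, t₀ ≤ t n := fun n => ht.zero ▸ hsm.monotone (Nat.zero_le n)
  refine ⟨h.contDiffOn.congr heq, fun s hs => heq hs ▸ h.pos s hs,
    (hd t₀ self_mem_Ici).trans_le h.deriv_nonpos, t, ⟨ht.zero, fun k => ?_, fun k => ?_⟩, hsm, hlim,
    hgap, ?_⟩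
  · convert ht.odd k using 1
    ext s
    refine and_congr_right fun hs => ?_
    rw [hd s ((hge _).trans hs.le)]
  · convert ht.even k using 1
    ext s
    refine and_congr_right fun hs => ?_
    rw [heq ((hge _).trans hs.le : s ∈ Ici t₀), heq (hge _ : t (2 * k + 1) ∈ Ici t₀)]
  · refine hosc.congr_left fun k => ?_
    have : EqOn ρ r (Icc (t (2 * k + 1)) (t (2 * k + 2))) :=
      heq.mono fun s hs => (hge _).trans hs.1
    rw [oscOn, oscOn, this.image_eq]

theorem oscOn_mem_Icc {r : ℝ → ℝ} {a b M : ℝ} (hab : a ≤ b) (hlow : ∀ s ∈ Icc a b, r a ≤ r s)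
    (hup : ∀ s ∈ Icc a b, r s ≤ r a + M) : oscOn r a b ∈ Icc 0 M := by
  have hne : (r '' Icc a b).Nonempty := (nonempty_Icc.2 hab).image r
  have hmem : r a ∈ r '' Icc a b := mem_image_of_mem r (left_mem_Icc.2 hab)
  have hbb : BddBelow (r '' Icc a b) := ⟨r a, by rintro _ ⟨s, hs, rfl⟩; exact hlow s hs⟩
  have hba : BddAbove (r '' Icc a b) := ⟨r a + M, by rintro _ ⟨s, hs, rfl⟩; exact hup s hs⟩
  have h1 : sSup (r '' Icc a b) ≤ r a + M :=
    csSup_le hne (by rintro _ ⟨s, hs, rfl⟩; exact hup s hs)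
  have h2 : r a ≤ sInf (r '' Icc a b) :=
    le_csInf hne (by rintro _ ⟨s, hs, rfl⟩; exact hlow s hs)
  have h3 := (csInf_le hbb hmem).trans (le_csSup hba hmem)
  constructor
  · rw [oscOn]; linarith
  · rw [oscOn]; linarith

theorem isLittleO_rpow_rpow_atTop {x y : ℝ} (h : x < y) :
    (fun t : ℝ => t ^ x) =o[atTop] fun t => t ^ y := by
  rw [isLittleO_iff_tendsto']
  · refine (tendsto_rpow_neg_atTop (sub_pos.2 h)).congr' ?_
    filter_upwards [eventually_gt_atTop 0] with t ht
    rw [← Real.rpow_sub ht, neg_sub]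
  · filter_upwards [eventually_gt_atTop 0] with t ht h0
    exact absurd h0 (Real.rpow_pos_of_pos ht y).ne'

namespace IsAmplitude

variable {α τ₀ : ℝ} {p p₁ p₂ p₃ : ℝ → ℝ}

theorem phaseRadius_le_add (H : IsAmplitude α τ₀ p p₁ p₂ p₃) {a b D : ℝ} (ha : τ₀ < a)
    (hD : ∀ s ∈ Icc a b, phaseRadiusDeriv p p₁ p₂ s ≤ D) {s : ℝ} (hs : s ∈ Icc a b) :
    phaseRadius p p₁ s ≤ phaseRadius p p₁ a + D * (s - a) := by
  have hder : ∀ s ∈ Icc a b, HasDerivAt (phaseRadius p p₁) (phaseRadiusDeriv p p₁ p₂ s) s :=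
    fun s hs => H.hasDerivAt_phaseRadius (ha.trans_le hs.1)
  have := (convex_Icc a b).image_sub_le_mul_sub_of_deriv_le
    (fun s hs => (hder s hs).continuousAt.continuousWithinAt)
    (fun s hs => (hder s (interior_subset hs)).differentiableAt.differentiableWithinAt)
    (C := D) (fun s hs => by
      rw [(hder s (interior_subset hs)).deriv]; exact hD s (interior_subset hs))
    a (left_mem_Icc.2 (hs.1.trans hs.2)) s hs hs.1
  linarith

theorem exists_isWavyFunction_phaseRadius (H : IsAmplitude α τ₀ p p₁ p₂ p₃) (hα1 : α ≠ 1) :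
    ∃ N : ℕ, ∀ n ≥ N, ∀ β < 1, IsWavyFunction β (phaseRadius p p₁) (n * Real.pi) := by
  have hα := H.exponent_pos
  have hpi := Real.pi_gt_three
  obtain ⟨T₁, hT₁⟩ := H.exists_rise_interval hα1
  obtain ⟨T₂, hT₂⟩ := H.exists_phaseRadius_decrease
  obtain ⟨c, hc, C, hC, hb⟩ := H.exists_phaseRadiusDeriv_bounds
  obtain ⟨T₃, hT₃⟩ := eventually_atTop.1 hb
  obtain ⟨N, hN⟩ := exists_nat_ge (|T₁| + |T₂| + |T₃| + τ₀ + 1)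
  refine ⟨N, fun n hn β hβ => ?_⟩
  have hτ₀ := H.start_pos
  have hlarge : ∀ k : ℕ, |T₁| + |T₂| + |T₃| + τ₀ + 1 ≤ (n + k : ℕ) * Real.pi := by
    intro k
    have h1 : (N : ℝ) ≤ (n + k : ℕ) := by exact_mod_cast hn.trans (Nat.le_add_right n k)
    have h2 : (0 : ℝ) ≤ (n + k : ℕ) := by positivity
    nlinarith
  have hlarge₀ : |T₁| + |T₂| + |T₃| + τ₀ + 1 ≤ n * Real.pi := by simpa using hlarge 0
  have A1 := abs_nonneg T₁
  have A2 := abs_nonneg T₂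
  have A3 := abs_nonneg T₃
  have B1 := le_abs_self T₁
  have B2 := le_abs_self T₂
  have B3 := le_abs_self T₃
  choose lo hi h1 h2 h3 h4 h5 h6 using fun k : ℕ => hT₁ (n + k) (by linarith [hlarge k])
  set m : ℕ → ℝ := fun k => (n + k : ℕ) * Real.pi + Real.pi / 2 with hm
  have hm_succ : ∀ k, m (k + 1) = m k + Real.pi := fun k => by simp only [hm]; push_cast; ring
  have hm_zero : m 0 = n * Real.pi + Real.pi / 2 := by simp [hm]
  have hm_ge : ∀ k, |T₁| + |T₂| + |T₃| + τ₀ + 1 + 1 ≤ m k := fun k => by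
    simp only [hm]; linarith [hlarge k]
  have hder : ∀ s ∈ Ici (n * Real.pi), HasDerivWithinAt (phaseRadius p p₁)
      (phaseRadiusDeriv p p₁ p₂ s) (Ici (n * Real.pi)) s := fun s hs =>
    (H.hasDerivAt_phaseRadius (by linarith [show n * Real.pi ≤ s from hs])).hasDerivWithinAt
  -- Rises lie within 1/4 of the points m k, which are π apart. From the start of a rise to m k + 1
  -- more than 1/2 elapses, so the radius has dropped below its starting level; and more than 1
  -- remains until the next rise.
  obtain ⟨t, hw, hsm, htop, hgap, hspec⟩ := exists_isWavySequence (ε := 1) one_pos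
    (a := fun k => m k + lo k) (b := fun k => m k + hi k) (c := fun k => m k + 1) hder
    (by have := h1 0; simp only [hm_zero]; linarith)
    (fun k => by simpa using h2 k) (fun k => by linarith [h3 k])
    (fun k => by simp only [hm_succ]; linarith [h1 (k + 1)])
    (fun k s hs => h4 k s hs)
    (fun s hs => h5 0 s (by simpa [hm] using hs))
    -- The stretch between two rises crosses a multiple of π, where the sign information of
    -- consecutive half turns is glued.
    (fun k s hs => by
      rcases le_total s ((n + k : ℕ) * Real.pi + Real.pi) with h | h
      · exact h6 k s ⟨hs.1, h⟩
      · refine h5 (k + 1) s ⟨le_trans (le_of_eq ?_) h, hs.2⟩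
        push_cast; ring)
    (fun k => hT₂ _ (by linarith [h1 k, hm_ge k]) _ (by linarith [h2 k, h3 k]))
  refine ⟨H.contDiffOn_phaseRadius (by linarith),
    fun s hs => H.phaseRadius_pos (show τ₀ ≤ s by linarith [show n * Real.pi ≤ s from hs]), ?_,
    t, hw, hsm, htop, ⟨1, one_pos, hgap⟩, ?_⟩
  · rw [(hder _ self_mem_Ici).derivWithin (uniqueDiffOn_Ici _ _ self_mem_Ici)]
    refine h5 0 _ ⟨by simp, ?_⟩
    simp only [add_zero]
    linarith [h1 0]
  · have hodd : Tendsto (fun k : ℕ => t (2 * k + 1)) atTop atTop :=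
      htop.comp (tendsto_atTop_mono (fun k => (by omega : k ≤ 2 * k + 1)) tendsto_id)
    -- Each excursion lasts less than 2, and on it r' ≤ C a^(-α-2) because the cos² term only helps.
    -- The exponent -α-2 is below -β-1 as β < 1 < 1 + α.
    have hO : (fun k : ℕ => oscOn (phaseRadius p p₁) (t (2 * k + 1)) (t (2 * k + 2))) =O[atTop]
        fun k : ℕ => t (2 * k + 1) ^ (-α - 2) := by
      refine IsBigO.of_bound (2 * C) (Eventually.of_forall fun k => ?_)
      obtain ⟨e1, e2, e3⟩ := hspec k
      have hlt : t (2 * k + 1) < t (2 * k + 2) := hsm (Nat.lt_succ_self _)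
      rw [← e1] at e3
      have ha : t (2 * k + 1) ≥ m k - 1 / 4 := by rw [e1]; linarith [h1 k]
      set a := t (2 * k + 1)
      have ha1 : |T₁| + |T₂| + |T₃| + τ₀ + 1 ≤ a := by linarith [hm_ge k]
      have ha0 : 0 < a := by linarith
      have hD : ∀ s ∈ Icc a (t (2 * k + 2)), phaseRadiusDeriv p p₁ p₂ s ≤ C * a ^ (-α - 2) := by
        intro s hs
        have hs0 : 0 < s := ha0.trans_le hs.1
        have h := (hT₃ s (by linarith [hs.1])).1
        have e : s ^ (-α) / s * (C / s) = C * s ^ (-α - 2) := by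
          rw [Real.rpow_sub hs0]
          norm_cast
          field_simp
        have h' : s ^ (-α - 2) ≤ a ^ (-α - 2) :=
          Real.rpow_le_rpow_of_nonpos ha0 hs.1 (by linarith)
        have h'' : 0 ≤ s ^ (-α) / s * (c * Real.cos s ^ 2) := by positivity
        have h3 : C * s ^ (-α - 2) ≤ C * a ^ (-α - 2) := mul_le_mul_of_nonneg_left h' hC.le
        linarith
      have hmem := oscOn_mem_Icc (M := 2 * C * a ^ (-α - 2)) hlt.le e3 (fun s hs => by
        have h := H.phaseRadius_le_add (by linarith : τ₀ < a) hD hs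
        have h' : s - a ≤ 2 := by linarith [hs.2]
        have h'' : 0 ≤ C * a ^ (-α - 2) := by positivity
        nlinarith)
      rw [Real.norm_eq_abs, abs_of_nonneg hmem.1, Real.norm_eq_abs,
        abs_of_pos (Real.rpow_pos_of_pos ha0 _)]
      exact hmem.2
    exact hO.trans_isLittleO ((isLittleO_rpow_rpow_atTop (by linarith)).comp_tendsto hodd)

end IsAmplitude

/-! ### The polar angle -/

noncomputable section

/-- The factor `z(t)` in `x(t) + i x'(t) = p(t) i exp(-i t) z(t)`. -/
def phaseFactor (p p₁ : ℝ → ℝ) (t : ℝ) : ℂ :=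
  1 + ((p₁ t / p t : ℝ) : ℂ) * ((Real.sin t : ℝ) : ℂ) * Complex.exp (t * Complex.I)

/-- The derivative of `phaseFactor`. -/
def phaseFactorDeriv (p p₁ p₂ : ℝ → ℝ) (t : ℝ) : ℂ :=
  (((p₂ t / p t - (p₁ t / p t) ^ 2 : ℝ) : ℂ) * ((Real.sin t : ℝ) : ℂ) +
      ((p₁ t / p t : ℝ) : ℂ) * ((Real.cos t : ℝ) : ℂ)) * Complex.exp (t * Complex.I) +
    ((p₁ t / p t : ℝ) : ℂ) * ((Real.sin t : ℝ) : ℂ) * (Complex.exp (t * Complex.I) * Complex.I)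

/-- A continuous polar angle of the phase curve of `p(t) sin t`. -/
def phaseAngle (p p₁ : ℝ → ℝ) (t : ℝ) : ℝ :=
  Real.pi / 2 - t + (phaseFactor p p₁ t).arg

/-- The derivative of `phaseAngle`. -/
def phaseAngleDeriv (p p₁ p₂ : ℝ → ℝ) (t : ℝ) : ℝ :=
  -1 + (phaseFactorDeriv p p₁ p₂ t / phaseFactor p p₁ t).im

end

theorem phaseFactor_re (p p₁ : ℝ → ℝ) (t : ℝ) :
    (phaseFactor p p₁ t).re = 1 + p₁ t / p t * Real.sin t * Real.cos t := by
  rw [phaseFactor, ← Complex.ofReal_mul, Complex.add_re, Complex.re_ofReal_mul,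
    Complex.exp_ofReal_mul_I_re, Complex.one_re]

theorem phaseFactor_im (p p₁ : ℝ → ℝ) (t : ℝ) :
    (phaseFactor p p₁ t).im = p₁ t / p t * Real.sin t * Real.sin t := by
  rw [phaseFactor, ← Complex.ofReal_mul, Complex.add_im, Complex.im_ofReal_mul,
    Complex.exp_ofReal_mul_I_im, Complex.one_im, zero_add]

/-- The imaginary part (p₁/p) sin² t vanishes only when (p₁/p) sin t = 0, and then the factor is 1.
Hence the principal argument is continuous along the whole curve and gives an explicit angle without
any lifting argument. -/
theorem phaseFactor_mem_slitPlane (p p₁ : ℝ → ℝ) (t : ℝ) :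
    phaseFactor p p₁ t ∈ Complex.slitPlane := by
  rw [Complex.mem_slitPlane_iff, phaseFactor_re, phaseFactor_im]
  by_cases h : p₁ t / p t * Real.sin t = 0
  · left; rw [h]; norm_num
  · right
    refine mul_ne_zero h ?_
    exact right_ne_zero_of_mul h

theorem abs_phaseAngle_add_le (p p₁ : ℝ → ℝ) (t : ℝ) : |phaseAngle p p₁ t + t| ≤ 2 * Real.pi := by
  have h := Complex.abs_arg_le_pi (phaseFactor p p₁ t)
  have hpi := Real.pi_pos
  rw [abs_le] at h ⊢
  rw [phaseAngle]
  constructor <;> linarith [h.1, h.2]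

theorem polarPoint_inj {ρ ρ' θ θ' : ℝ} (hρ : 0 < ρ) (hρ' : 0 < ρ')
    (h : polarPoint ρ θ = polarPoint ρ' θ') : ρ = ρ' ∧ ∃ n : ℤ, θ = θ' + n * (2 * Real.pi) := by
  have h0 : ρ * Real.cos θ = ρ' * Real.cos θ' := by simpa [polarPoint] using congrArg (· 0) h
  have h1 : ρ * Real.sin θ = ρ' * Real.sin θ' := by simpa [polarPoint] using congrArg (· 1) h
  have hsq : ρ ^ 2 = ρ' ^ 2 := by
    have e : ρ ^ 2 = (ρ * Real.cos θ) ^ 2 + (ρ * Real.sin θ) ^ 2 := by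
      linear_combination -(ρ ^ 2) * Real.sin_sq_add_cos_sq θ
    rw [e, h0, h1]
    linear_combination (ρ' ^ 2) * Real.sin_sq_add_cos_sq θ'
  have hρρ : ρ = ρ' := (sq_eq_sq₀ hρ.le hρ'.le).1 hsq
  subst hρρ
  have hc := mul_left_cancel₀ hρ.ne' h0
  have hs := mul_left_cancel₀ hρ.ne' h1
  refine ⟨rfl, ?_⟩
  have : (θ : Real.Angle) = θ' := Real.Angle.cos_sin_inj hc hs
  obtain ⟨n, hn⟩ := Real.Angle.angle_eq_iff_two_pi_dvd_sub.1 this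
  exact ⟨n, by linarith⟩

theorem norm_polarPoint {ρ θ : ℝ} (hρ : 0 ≤ ρ) : ‖polarPoint ρ θ‖ = ρ := by
  rw [EuclideanSpace.norm_eq, Fin.sum_univ_two]
  simp only [polarPoint, Real.norm_eq_abs, sq_abs, Matrix.cons_val_zero, Matrix.cons_val_one]
  rw [show (ρ * Real.cos θ) ^ 2 + (ρ * Real.sin θ) ^ 2 = ρ ^ 2 by
    linear_combination (ρ ^ 2) * Real.sin_sq_add_cos_sq θ]
  exact Real.sqrt_sq hρ

theorem IsPreconnected.eq_of_forall_int {g : ℝ → ℝ} {s : Set ℝ} (hs : IsPreconnected s)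
    (hg : ContinuousOn g s) (h : ∀ t ∈ s, ∃ n : ℤ, g t = n) {a b : ℝ} (ha : a ∈ s) (hb : b ∈ s) :
    g a = g b := by
  have : DiscreteTopology (range ((↑) : ℤ → ℝ)) :=
    Int.isClosedEmbedding_coe_real.isEmbedding.toHomeomorph.symm.isEmbedding.discreteTopology
  exact hs.constant_of_mapsTo (T := range ((↑) : ℤ → ℝ)) ⟨this⟩ hg
    (fun t ht => by obtain ⟨n, hn⟩ := h t ht; exact ⟨n, hn.symm⟩) ha hb

namespace IsAmplitude

variable {α τ₀ : ℝ} {p p₁ p₂ p₃ : ℝ → ℝ}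

/-- In x + i x' = p · i exp(-it) · z the middle factor contributes the angle π/2 - t, and z
contributes arg z and the modulus. -/
theorem phaseRadius_eq (H : IsAmplitude α τ₀ p p₁ p₂ p₃) {t : ℝ} (ht : t ∈ Ici τ₀) :
    p t * Real.sin t = phaseRadius p p₁ t * Real.cos (phaseAngle p p₁ t) ∧
      phaseVelocity p p₁ t = phaseRadius p p₁ t * Real.sin (phaseAngle p p₁ t) := by
  have hp := H.pos t ht
  set z := phaseFactor p p₁ t with hz
  have hre : ‖z‖ * Real.cos z.arg = 1 + p₁ t / p t * Real.sin t * Real.cos t := by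
    rw [Complex.norm_mul_cos_arg, hz, phaseFactor_re]
  have him : ‖z‖ * Real.sin z.arg = p₁ t / p t * Real.sin t * Real.sin t := by
    rw [Complex.norm_mul_sin_arg, hz, phaseFactor_im]
  have e1 : p t * Real.sin t = p t * ‖z‖ * Real.cos (phaseAngle p p₁ t) := by
    rw [phaseAngle, ← hz, show Real.pi / 2 - t + z.arg = Real.pi / 2 - (t - z.arg) by ring,
      Real.cos_pi_div_two_sub, Real.sin_sub]
    linear_combination -(p t * Real.sin t) * hre + (p t * Real.cos t) * him
  have e2 : phaseVelocity p p₁ t = p t * ‖z‖ * Real.sin (phaseAngle p p₁ t) := by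
    have h3 : p₁ t = p t * (p₁ t / p t) := by field_simp
    rw [phaseAngle, ← hz, show Real.pi / 2 - t + z.arg = Real.pi / 2 - (t - z.arg) by ring,
      Real.sin_pi_div_two_sub, Real.cos_sub, phaseVelocity]
    linear_combination -(p t * Real.cos t) * hre - (p t * Real.sin t) * him + Real.sin t * h3
      - (p t * (p₁ t / p t) * Real.sin t) * Real.sin_sq_add_cos_sq t
  have e3 : phaseRadius p p₁ t = p t * ‖z‖ := by
    rw [phaseRadius, e1, e2]
    rw [show (p t * ‖z‖ * Real.cos (phaseAngle p p₁ t)) ^ 2 +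
      (p t * ‖z‖ * Real.sin (phaseAngle p p₁ t)) ^ 2 = (p t * ‖z‖) ^ 2 by
        linear_combination ((p t * ‖z‖) ^ 2) * Real.sin_sq_add_cos_sq (phaseAngle p p₁ t)]
    exact Real.sqrt_sq (by positivity)
  rw [e3]
  exact ⟨e1, e2⟩

theorem phasePoint_eq (H : IsAmplitude α τ₀ p p₁ p₂ p₃) {x : ℝ → ℝ}
    (hx : ∀ t ∈ Ici τ₀, x t = p t * Real.sin t) {t : ℝ} (ht : t ∈ Ici τ₀) :
    phasePoint x τ₀ t = !₂[p t * Real.sin t, phaseVelocity p p₁ t] := by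
  rw [phasePoint, hx t ht, derivWithin_congr hx (hx t ht),
    (H.hasDerivWithinAt_mul_sin ht).derivWithin (uniqueDiffOn_Ici _ t ht)]

theorem phasePoint_eq_polarPoint (H : IsAmplitude α τ₀ p p₁ p₂ p₃) {x : ℝ → ℝ}
    (hx : ∀ t ∈ Ici τ₀, x t = p t * Real.sin t) {t : ℝ} (ht : t ∈ Ici τ₀) :
    phasePoint x τ₀ t = polarPoint (phaseRadius p p₁ t) (phaseAngle p p₁ t) := by
  rw [H.phasePoint_eq hx ht, polarPoint, (H.phaseRadius_eq ht).1, (H.phaseRadius_eq ht).2]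

theorem continuousOn_phaseFactor (H : IsAmplitude α τ₀ p p₁ p₂ p₃) :
    ContinuousOn (phaseFactor p p₁) (Ici τ₀) := by
  have c := H.continuousOn₁.div H.continuousOn fun t ht => (H.pos t ht).ne'
  refine continuousOn_const.add (((Complex.continuous_ofReal.comp_continuousOn c).mul
    (Continuous.continuousOn ?_)).mul (Continuous.continuousOn ?_)) <;> fun_prop

theorem continuousOn_phaseFactorDeriv (H : IsAmplitude α τ₀ p p₁ p₂ p₃) :
    ContinuousOn (phaseFactorDeriv p p₁ p₂) (Ici τ₀) := by
  have c := H.continuousOn₁.div H.continuousOn fun t ht => (H.pos t ht).ne'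
  have c' := H.continuousOn₂.div H.continuousOn fun t ht => (H.pos t ht).ne'
  have d := Complex.continuous_ofReal.comp_continuousOn c
  have d' := Complex.continuous_ofReal.comp_continuousOn (c'.sub (c.pow 2))
  have s : ContinuousOn (fun t : ℝ => ((Real.sin t : ℝ) : ℂ)) (Ici τ₀) :=
    Continuous.continuousOn (by fun_prop)
  have k : ContinuousOn (fun t : ℝ => ((Real.cos t : ℝ) : ℂ)) (Ici τ₀) :=
    Continuous.continuousOn (by fun_prop)
  have e : ContinuousOn (fun t : ℝ => Complex.exp (t * Complex.I)) (Ici τ₀) :=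
    Continuous.continuousOn (by fun_prop)
  exact (((d'.mul s).add (d.mul k)).mul e).add ((d.mul s).mul (e.mul continuousOn_const))

theorem continuousOn_phaseAngle (H : IsAmplitude α τ₀ p p₁ p₂ p₃) :
    ContinuousOn (phaseAngle p p₁) (Ici τ₀) := by
  refine (continuousOn_const.sub continuousOn_id).add fun t ht => ?_
  exact (Complex.continuousAt_arg (phaseFactor_mem_slitPlane p p₁ t)).comp_continuousWithinAt
    (H.continuousOn_phaseFactor t ht)

theorem isPhaseAngle_phaseAngle (H : IsAmplitude α τ₀ p p₁ p₂ p₃) {x : ℝ → ℝ}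
    (hx : ∀ t ∈ Ici τ₀, x t = p t * Real.sin t) : IsPhaseAngle x τ₀ (phaseAngle p p₁) :=
  ⟨H.continuousOn_phaseAngle, fun _ ht =>
    ⟨_, H.phaseRadius_pos ht, H.phasePoint_eq_polarPoint hx ht⟩⟩

/-- Two continuous angles differ by a continuous function with values in 2πℤ, which is constant on a
half line. So estimates on differences of the explicit angle hold for every angle. -/
theorem exists_eq_phaseAngle_add (H : IsAmplitude α τ₀ p p₁ p₂ p₃) {x φ : ℝ → ℝ}
    (hx : ∀ t ∈ Ici τ₀, x t = p t * Real.sin t) (hφ : IsPhaseAngle x τ₀ φ) :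
    ∃ c, (∀ t ∈ Ici τ₀, φ t = phaseAngle p p₁ t + c) ∧
      ∀ t ∈ Ici τ₀, phasePoint x τ₀ t = polarPoint (phaseRadius p p₁ t) (φ t) := by
  have h2pi : (2 * Real.pi) ≠ 0 := by positivity
  have key : ∀ t ∈ Ici τ₀, phasePoint x τ₀ t = polarPoint (phaseRadius p p₁ t) (φ t) ∧
      ∃ n : ℤ, (φ t - phaseAngle p p₁ t) / (2 * Real.pi) = n := by
    intro t ht
    obtain ⟨ρ, hρ, h⟩ := hφ.2 t ht
    obtain ⟨rfl, n, hn⟩ := polarPoint_inj hρ (H.phaseRadius_pos ht)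
      (h.symm.trans (H.phasePoint_eq_polarPoint hx ht))
    exact ⟨h, n, by rw [hn]; field_simp; ring⟩
  refine ⟨φ τ₀ - phaseAngle p p₁ τ₀, fun t ht => ?_, fun t ht => (key t ht).1⟩
  have h := IsPreconnected.eq_of_forall_int isPreconnected_Ici
    ((hφ.1.sub H.continuousOn_phaseAngle).div_const (2 * Real.pi)) (fun t ht => (key t ht).2) ht
    (self_mem_Ici (a := τ₀))
  rw [div_left_inj' h2pi] at h
  simp only [Pi.sub_apply] at h
  linarith

theorem hasDerivAt_phaseFactor (H : IsAmplitude α τ₀ p p₁ p₂ p₃) {t : ℝ} (ht : τ₀ < t) :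
    HasDerivAt (phaseFactor p p₁) (phaseFactorDeriv p p₁ p₂ t) t := by
  have e : HasDerivAt (fun t : ℝ => Complex.exp (t * Complex.I))
      (Complex.exp (t * Complex.I) * Complex.I) t := by
    have := ((hasDerivAt_id t).ofReal_comp.mul_const Complex.I).cexp
    simpa using this
  exact ((((H.hasDerivAt_logDeriv ht).ofReal_comp.mul (Real.hasDerivAt_sin t).ofReal_comp).mul
    e).const_add 1)

theorem hasDerivAt_phaseAngle (H : IsAmplitude α τ₀ p p₁ p₂ p₃) {t : ℝ} (ht : τ₀ < t) :
    HasDerivAt (phaseAngle p p₁) (phaseAngleDeriv p p₁ p₂ t) t := by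
  have h := (H.hasDerivAt_phaseFactor ht).clog_real (phaseFactor_mem_slitPlane p p₁ t)
  have h' : HasDerivAt (fun t => (phaseFactor p p₁ t).arg)
      (phaseFactorDeriv p p₁ p₂ t / phaseFactor p p₁ t).im t := by
    simpa [Function.comp_def, Complex.log_im] using Complex.imCLM.hasFDerivAt.comp_hasDerivAt t h
  exact ((hasDerivAt_id t).const_sub (Real.pi / 2)).add h'

theorem contDiffOn_phaseAngle (H : IsAmplitude α τ₀ p p₁ p₂ p₃) {t₀ : ℝ} (ht₀ : τ₀ < t₀) :
    ContDiffOn ℝ 1 (phaseAngle p p₁) (Ici t₀) := by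
  have hder : ∀ t ∈ Ici t₀, HasDerivWithinAt (phaseAngle p p₁) (phaseAngleDeriv p p₁ p₂ t)
      (Ici t₀) t := fun t ht => (H.hasDerivAt_phaseAngle (ht₀.trans_le ht)).hasDerivWithinAt
  have hsub : Ici t₀ ⊆ Ici τ₀ := Ici_subset_Ici.2 ht₀.le
  rw [contDiffOn_one_iff_derivWithin (uniqueDiffOn_Ici t₀)]
  refine ⟨fun t ht => (hder t ht).differentiableWithinAt, ?_⟩
  have : ContinuousOn (phaseAngleDeriv p p₁ p₂) (Ici t₀) :=
    continuousOn_const.add (Complex.continuous_im.comp_continuousOn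
      ((H.continuousOn_phaseFactorDeriv.mono hsub).div (H.continuousOn_phaseFactor.mono hsub)
        fun t _ => Complex.slitPlane_ne_zero (phaseFactor_mem_slitPlane p p₁ t)))
  exact this.congr fun t ht => (hder t ht).derivWithin (uniqueDiffOn_Ici t₀ t ht)

/-- The factor z tends to 1 and z' to 0, since p₁/p and p₂/p tend to 0 and the trigonometric factors
are bounded. -/
theorem tendsto_phaseAngleDeriv (H : IsAmplitude α τ₀ p p₁ p₂ p₃) :
    Tendsto (phaseAngleDeriv p p₁ p₂) atTop (𝓝 (-1)) := by
  have bs : ∀ t : ℝ, ‖((Real.sin t : ℝ) : ℂ)‖ ≤ 1 := fun t => by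
    rw [Complex.norm_real]; exact Real.abs_sin_le_one t
  have bc : ∀ t : ℝ, ‖((Real.cos t : ℝ) : ℂ)‖ ≤ 1 := fun t => by
    rw [Complex.norm_real]; exact Real.abs_cos_le_one t
  have be : ∀ t : ℝ, ‖Complex.exp (t * Complex.I)‖ ≤ 1 := fun t => by
    rw [Complex.norm_exp_ofReal_mul_I]
  have a0 : Tendsto (fun t => ((p₁ t / p t : ℝ) : ℂ)) atTop (𝓝 0) := by
    exact (Complex.continuous_ofReal.tendsto' 0 0 Complex.ofReal_zero).comp H.tendsto_logDeriv
  have a1 : Tendsto (fun t => ((p₂ t / p t - (p₁ t / p t) ^ 2 : ℝ) : ℂ)) atTop (𝓝 0) := by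
    have h := H.tendsto_second_div.sub (H.tendsto_logDeriv.pow 2)
    norm_num at h
    exact (Complex.continuous_ofReal.tendsto' 0 0 Complex.ofReal_zero).comp h
  have bdd : ∀ {f g : ℝ → ℂ}, Tendsto f atTop (𝓝 0) → (∀ t, ‖g t‖ ≤ 1) →
      Tendsto (fun t => f t * g t) atTop (𝓝 0) := by
    intro f g hf hg
    refine squeeze_zero_norm (fun t => ?_) (tendsto_zero_iff_norm_tendsto_zero.1 hf)
    rw [norm_mul]
    exact mul_le_of_le_one_right (norm_nonneg _) (hg t)
  have z1 : Tendsto (phaseFactor p p₁) atTop (𝓝 1) := by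
    have := (bdd (bdd a0 bs) be).const_add 1
    rwa [add_zero] at this
  have z0 : Tendsto (phaseFactorDeriv p p₁ p₂) atTop (𝓝 0) := by
    have h1 := (bdd a1 bs).add (bdd a0 bc)
    rw [add_zero] at h1
    have h2 := bdd (bdd a0 bs) (g := fun t => Complex.exp (t * Complex.I) * Complex.I)
      (fun t => by rw [norm_mul, Complex.norm_I, mul_one]; exact be t)
    have := (bdd h1 be).add h2
    rwa [add_zero] at this
  have h := ((Complex.continuous_im.tendsto _).comp (z0.div z1 one_ne_zero)).const_add (-1)
  simp only [zero_div, Complex.zero_im, add_zero] at h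
  exact h

theorem exists_phaseAngle_sub_bounds (H : IsAmplitude α τ₀ p p₁ p₂ p₃) :
    ∃ T, ∀ t ≥ T, ∀ t' ≥ t, (t' - t) / 2 ≤ phaseAngle p p₁ t - phaseAngle p p₁ t' ∧
      phaseAngle p p₁ t - phaseAngle p p₁ t' ≤ 2 * (t' - t) := by
  have h := H.tendsto_phaseAngleDeriv
  obtain ⟨T, hT⟩ := eventually_atTop.1 (((h.eventually_const_lt (by norm_num : (-2 : ℝ) < -1)).and
    (h.eventually_lt_const (by norm_num : (-1 : ℝ) < -1 / 2))).and (eventually_gt_atTop τ₀))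
  refine ⟨T, fun t ht t' ht' => ?_⟩
  have hder : ∀ s ∈ Icc t t', HasDerivAt (phaseAngle p p₁) (phaseAngleDeriv p p₁ p₂ s) s :=
    fun s hs => H.hasDerivAt_phaseAngle (hT s (ht.trans hs.1)).2
  have hcont : ContinuousOn (phaseAngle p p₁) (Icc t t') :=
    fun s hs => (hder s hs).continuousAt.continuousWithinAt
  have hdiff : DifferentiableOn ℝ (phaseAngle p p₁) (interior (Icc t t')) :=
    fun s hs => (hder s (interior_subset hs)).differentiableAt.differentiableWithinAt
  have h1 := (convex_Icc t t').image_sub_le_mul_sub_of_deriv_le hcont hdiff (C := -1 / 2)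
    (fun s hs => by
      rw [(hder s (interior_subset hs)).deriv]
      exact (hT s (ht.trans (interior_subset hs).1)).1.2.le)
    t (left_mem_Icc.2 ht') t' (right_mem_Icc.2 ht') ht'
  have h2 := (convex_Icc t t').mul_sub_le_image_sub_of_le_deriv hcont hdiff (C := -2)
    (fun s hs => by
      rw [(hder s (interior_subset hs)).deriv]
      exact (hT s (ht.trans (interior_subset hs).1)).1.1.le)
    t (left_mem_Icc.2 ht') t' (right_mem_Icc.2 ht') ht'
  constructor <;> linarith

end IsAmplitude

/-! ### The wavy spiral -/

/-- A continuous function on `[t₁, ∞)` decreasing with speed between `1/2` and `2` maps `[t₁, ∞)`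
bijectively onto `(-∞, φ(t₁)]`. -/
theorem image_Ici_eq_Iic_of_sub_bounds {φ : ℝ → ℝ} {t₁ : ℝ} (hc : ContinuousOn φ (Ici t₁))
    (hb : ∀ t ≥ t₁, ∀ t' ≥ t, (t' - t) / 2 ≤ φ t - φ t') : φ '' Ici t₁ = Iic (φ t₁) := by
  apply Subset.antisymm
  · rintro _ ⟨t, ht, rfl⟩
    have := hb t₁ le_rfl t ht
    have h' : t₁ ≤ t := ht
    exact show φ t ≤ φ t₁ by linarith
  · intro θ (hθ : θ ≤ φ t₁)
    set t := t₁ + 2 * (φ t₁ - θ) with ht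
    have htt : t₁ ≤ t := by linarith
    have h := hb t₁ le_rfl t htt
    obtain ⟨s, hs, hsθ⟩ := intermediate_value_Icc' htt (hc.mono Icc_subset_Ici_self)
      (⟨by linarith, hθ⟩ : θ ∈ Icc (φ t) (φ t₁))
    exact ⟨s, hs.1, hsθ⟩

namespace IsAmplitude

variable {α τ₀ : ℝ} {p p₁ p₂ p₃ : ℝ → ℝ}

theorem tendsto_phaseRadius (H : IsAmplitude α τ₀ p p₁ p₂ p₃) :
    Tendsto (phaseRadius p p₁) atTop (𝓝 0) := by
  have h := (tendsto_rpow_neg_atTop H.exponent_pos).const_mul 2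
  rw [mul_zero] at h
  refine tendsto_of_tendsto_of_tendsto_of_le_of_le' tendsto_const_nhds h ?_ ?_
  · exact Eventually.of_forall fun t => Real.sqrt_nonneg _
  · exact H.eventually_phaseRadius_bounds.mono fun t h => h.2

/-- The function f is the radius composed with the inverse of φ. The angle has speed at most 2, so a
full turn takes time at least π > 1/2, and the radius decreases over it. -/
theorem exists_wavySpiral (H : IsAmplitude α τ₀ p p₁ p₂ p₃) (hα1 : α ≠ 1) {x φ : ℝ → ℝ}
    (hx : ∀ t ∈ Ici τ₀, x t = p t * Real.sin t) (hφ : IsPhaseAngle x τ₀ φ) :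
    ∃ (f : ℝ → ℝ) (φ₀ : ℝ), IsWavySpiralNearOrigin x τ₀ φ f φ₀ ∧
      Comparable atBot f (fun θ => |θ| ^ (-α)) := by
  have hα := H.exponent_pos
  have hpi := Real.pi_gt_three
  obtain ⟨c, hc, hpolar⟩ := H.exists_eq_phaseAngle_add hx hφ
  obtain ⟨N, hN⟩ := H.exists_isWavyFunction_phaseRadius hα1
  obtain ⟨T₁, hT₁⟩ := H.exists_phaseRadius_decrease
  obtain ⟨T₂, hT₂⟩ := H.exists_phaseAngle_sub_bounds
  obtain ⟨M, hM⟩ := exists_nat_ge (|T₁| + |T₂| + τ₀ + 1 + 2 * Real.pi + |c|)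
  set n := max N M with hn
  -- A multiple of π, because waviness of the radius is known from such starting times; the size of
  -- M also forces φ(t₁) < 0.
  set t₁ := n * Real.pi with ht₁
  have hτ₀ := H.start_pos
  have hlarge : |T₁| + |T₂| + τ₀ + 1 + 2 * Real.pi + |c| ≤ t₁ := by
    have h1 : (M : ℝ) ≤ n := by exact_mod_cast le_max_right N M
    have h2 : (0 : ℝ) ≤ n := by positivity
    nlinarith
  have A1 := abs_nonneg T₁
  have A2 := abs_nonneg T₂
  have A3 := abs_nonneg c
  have B1 := le_abs_self T₁
  have B2 := le_abs_self T₂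
  have B3 := le_abs_self c
  have hτt : τ₀ < t₁ := by linarith
  have hsub : Ici t₁ ⊆ Ici τ₀ := Ici_subset_Ici.2 hτt.le
  have hb : ∀ t ≥ t₁, ∀ t' ≥ t, (t' - t) / 2 ≤ φ t - φ t' ∧ φ t - φ t' ≤ 2 * (t' - t) := by
    intro t ht t' ht'
    rw [hc t (hsub ht), hc t' (hsub (ht.le.trans ht'))]
    have := hT₂ t (by linarith) t' ht'
    constructor <;> linarith [this.1, this.2]
  have hneg : φ t₁ < 0 := by
    rw [hc t₁ hτt.le]
    have := (abs_le.1 (abs_phaseAngle_add_le p p₁ t₁)).2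
    linarith
  have hanti : StrictAntiOn φ (Ici t₁) := by
    intro t ht t' _ htt
    have := (hb t ht t' htt.le).1
    linarith
  have hcont : ContinuousOn φ (Ici t₁) := hφ.1.mono hsub
  have himage : φ '' Ici t₁ = Iic (φ t₁) :=
    image_Ici_eq_Iic_of_sub_bounds hcont fun t ht t' ht' => (hb t ht t' ht').1
  set ψ := Function.invFunOn φ (Ici t₁) with hψ
  have hψ_mem : ∀ θ ≤ φ t₁, t₁ ≤ ψ θ ∧ φ (ψ θ) = θ := by
    intro θ hθ
    have h : θ ∈ φ '' Ici t₁ := himage ▸ hθ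
    exact ⟨Function.invFunOn_mem h, Function.invFunOn_eq h⟩
  have hψ_left : ∀ t ∈ Ici t₁, ψ (φ t) = t := fun t ht =>
    hanti.injOn.leftInvOn_invFunOn ht
  have hψ_up : ∀ θ ≤ φ t₁, ψ θ ≤ t₁ + 2 * (φ t₁ - θ) := by
    intro θ hθ
    obtain ⟨h1, h2⟩ := hψ_mem θ hθ
    have := (hb t₁ le_rfl (ψ θ) h1).1
    rw [h2] at this
    linarith
  have hψ_low : ∀ θ ≤ φ t₁, t₁ + (φ t₁ - θ) / 2 ≤ ψ θ := by
    intro θ hθ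
    obtain ⟨h1, h2⟩ := hψ_mem θ hθ
    have := (hb t₁ le_rfl (ψ θ) h1).2
    rw [h2] at this
    linarith
  have hψ_top : Tendsto ψ atBot atTop := by
    refine tendsto_atTop_mono' _ ((eventually_le_atBot (φ t₁)).mono hψ_low) ?_
    refine tendsto_atTop_add_const_left _ _ (Tendsto.atTop_div_const two_pos ?_)
    exact tendsto_atTop_add_const_left _ _ tendsto_neg_atBot_atTop
  refine ⟨fun θ => phaseRadius p p₁ (ψ θ), -φ t₁, ⟨by linarith, t₁, hτt.le, ?_, ?_⟩, ?_⟩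
  · rw [neg_neg]
    refine ⟨⟨by linarith, ?_, ?_, ?_⟩, ?_, Or.inr hanti, himage, ?_⟩
    · intro θ hθ
      have hθ' : -φ t₁ ≤ θ := hθ
      exact H.phaseRadius_pos (hsub (hψ_mem (-θ) (by linarith)).1)
    · exact H.tendsto_phaseRadius.comp (hψ_top.comp tendsto_neg_atTop_atBot)
    · intro θ hθ
      have hθ' : -φ t₁ ≤ θ := hθ
      refine strictAnti_nat_of_succ_lt fun k => ?_
      have hk : 0 ≤ 2 * (k : ℝ) * Real.pi := by positivity
      have e : -(θ + 2 * ((k + 1 : ℕ) : ℝ) * Real.pi) = -(θ + 2 * k * Real.pi) - 2 * Real.pi := by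
        push_cast; ring
      rw [e]
      set θ' := -(θ + 2 * k * Real.pi) with hθ''
      have h1 := hψ_mem θ' (by linarith)
      have h2 := hψ_mem (θ' - 2 * Real.pi) (by linarith)
      have hle : ψ θ' ≤ ψ (θ' - 2 * Real.pi) := by
        rw [← hanti.le_iff_ge h2.1 h1.1, h1.2, h2.2]
        linarith
      have h3 := (hb _ h1.1 _ hle).2
      rw [h1.2, h2.2] at h3
      exact hT₁ _ (by linarith [h1.1]) _ (by linarith)
    · exact ((H.contDiffOn_phaseAngle hτt).add contDiffOn_const).congr fun t ht => hc t (hsub ht)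
    · intro β hβ
      refine (hN n (le_max_left _ _) β hβ.2).congr fun t ht => ?_
      rw [hψ_left t ht]
  · intro t ht
    simp only [hψ_left t ht]
    exact hpolar t (hsub ht)
  -- For t ≥ 6t₁ + 6|φ(t₁)| the additive constants are absorbed and |θ|/t lies in [1/3, 3]; the
  -- factors 2 come from the bounds of the radius by t^(-α).
  · refine ⟨3 ^ (-α) / 2, by positivity, 2 * 3 ^ α, by positivity, ?_⟩
    have hr := hψ_top.eventually H.eventually_phaseRadius_bounds
    have hbig := hψ_top.eventually_ge_atTop (6 * t₁ + 6 * |φ t₁|)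
    filter_upwards [hr, hbig, eventually_le_atBot (φ t₁)] with θ ⟨h1, h2⟩ h3 h4
    have hu := hψ_up θ h4
    have hl := hψ_low θ h4
    set t := ψ θ
    have hθabs : |θ| = -θ := abs_of_neg (by linarith)
    have hφabs : |φ t₁| = -φ t₁ := abs_of_neg hneg
    rw [hφabs] at h3
    have ht0 : 0 < t := by linarith
    have b1 : |θ| ≤ 3 * t := by rw [hθabs]; linarith
    have b2 : 3⁻¹ * t ≤ |θ| := by rw [hθabs]; linarith
    have hθ0 : 0 < |θ| := lt_of_lt_of_le (by positivity) b2
    have g1 : (3 * t) ^ (-α) ≤ |θ| ^ (-α) :=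
      Real.rpow_le_rpow_of_nonpos hθ0 b1 (by linarith)
    have g2 : |θ| ^ (-α) ≤ (3⁻¹ * t) ^ (-α) :=
      Real.rpow_le_rpow_of_nonpos (by positivity) b2 (by linarith)
    rw [Real.mul_rpow (by norm_num) ht0.le] at g1 g2
    rw [Real.inv_rpow (by norm_num), ← Real.rpow_neg (by norm_num : (0 : ℝ) ≤ 3), neg_neg] at g2
    have p1 : (0 : ℝ) < 3 ^ (-α) := by positivity
    have p2 : (0 : ℝ) < 3 ^ α := by positivity
    constructor
    · refine le_trans ?_ g1
      nlinarith
    · refine g2.trans ?_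
      nlinarith

end IsAmplitude

/-! ### Increments and length of the curve -/

theorem exists_forall_abs_le_mul_rpow {q : ℝ → ℝ} {α τ₀ C : ℝ} (hτ₀ : 0 < τ₀)
    (hc : ContinuousOn q (Ici τ₀)) (hq : ∀ᶠ t in atTop, |q t| ≤ C * t ^ (-α)) :
    ∃ K, ∀ t ∈ Ici τ₀, |q t| ≤ K * t ^ (-α) := by
  obtain ⟨T, hT⟩ := eventually_atTop.1 hq
  have hcont : ContinuousOn (fun t => q t * t ^ α) (Icc τ₀ T) :=
    (hc.mono Icc_subset_Ici_self).mul fun t ht =>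
      (Real.continuousAt_rpow_const t α (Or.inl (hτ₀.trans_le ht.1).ne')).continuousWithinAt
  obtain ⟨K, hK⟩ := isCompact_Icc.exists_bound_of_continuousOn hcont
  refine ⟨max K C, fun t ht => ?_⟩
  have ht0 : 0 < t := hτ₀.trans_le ht
  have hu := Real.rpow_nonneg ht0.le (-α)
  rcases le_total t T with h | h
  · have h1 := hK t ⟨ht, h⟩
    rw [Real.norm_eq_abs, abs_mul, abs_of_nonneg (Real.rpow_nonneg ht0.le α)] at h1
    have e : |q t| = |q t| * t ^ α * t ^ (-α) := by
      rw [mul_assoc, ← Real.rpow_add ht0]; simp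
    rw [e]
    exact mul_le_mul_of_nonneg_right (h1.trans (le_max_left _ _)) hu
  · exact (hT t h).trans (mul_le_mul_of_nonneg_right (le_max_right _ _) hu)

/-- The same primitive K t^(1-α)/(1-α) of K t^(-α) serves α < 1 and α > 1; subtracting it from q, or
adding it to q, gives a monotone function. -/
theorem abs_sub_le_of_abs_deriv_le_rpow {q q' : ℝ → ℝ} {α τ₀ K : ℝ} (hα1 : α ≠ 1) (hτ₀ : 0 < τ₀)
    (hder : ∀ t ∈ Ici τ₀, HasDerivWithinAt q (q' t) (Ici τ₀) t)
    (hle : ∀ t ∈ Ici τ₀, |q' t| ≤ K * t ^ (-α)) {t t' : ℝ} (ht : t ∈ Ici τ₀) (htt : t ≤ t') :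
    |q t' - q t| ≤ K * (t' ^ (1 - α) / (1 - α)) - K * (t ^ (1 - α) / (1 - α)) := by
  have h1α : 1 - α ≠ 0 := sub_ne_zero.2 hα1.symm
  have hU : ∀ s ∈ Ici τ₀, HasDerivAt (fun s : ℝ => K * (s ^ (1 - α) / (1 - α))) (K * s ^ (-α)) s := by
    intro s hs
    have hs0 : s ≠ 0 := (hτ₀.trans_le hs).ne'
    refine (((Real.hasDerivAt_rpow_const (p := 1 - α) (Or.inl hs0)).div_const (1 - α)).const_mul
      K).congr_deriv ?_
    rw [show 1 - α - 1 = -α by ring]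
    field_simp
  have hcq : ContinuousOn q (Ici τ₀) := fun s hs => (hder s hs).continuousWithinAt
  have hcU : ContinuousOn (fun s : ℝ => K * (s ^ (1 - α) / (1 - α))) (Ici τ₀) := fun s hs =>
    (hU s hs).continuousAt.continuousWithinAt
  have hq : ∀ s ∈ interior (Ici τ₀), HasDerivAt q (q' s) s := by
    intro s hs
    rw [interior_Ici] at hs
    exact (hder s (mem_Ioi.1 hs).le).hasDerivAt (Ici_mem_nhds hs)
  have hup := antitoneOn_of_deriv_nonpos (convex_Ici τ₀) (hcq.sub hcU)
    (fun s hs => ((hq s hs).sub (hU s (interior_subset hs))).differentiableAt.differentiableWithinAt)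
    (fun s hs => by
      rw [((hq s hs).sub (hU s (interior_subset hs))).deriv]
      linarith [(abs_le.1 (hle s (interior_subset hs))).2])
  have hlo := monotoneOn_of_deriv_nonneg (convex_Ici τ₀) (hcq.add hcU)
    (fun s hs => ((hq s hs).add (hU s (interior_subset hs))).differentiableAt.differentiableWithinAt)
    (fun s hs => by
      rw [((hq s hs).add (hU s (interior_subset hs))).deriv]
      linarith [(abs_le.1 (hle s (interior_subset hs))).1])
  have h1 := hup ht (le_trans ht htt : t' ∈ Ici τ₀) htt
  have h2 := hlo ht (le_trans ht htt : t' ∈ Ici τ₀) htt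
  simp only [Pi.sub_apply, Pi.add_apply] at h1 h2
  rw [abs_le]
  constructor <;> linarith

theorem dist_le_abs_add_abs (a b c d : ℝ) :
    dist (!₂[a, b] : EuclideanSpace ℝ (Fin 2)) !₂[c, d] ≤ |a - c| + |b - d| := by
  rw [EuclideanSpace.dist_eq, Fin.sum_univ_two]
  simp only [Matrix.cons_val_zero, Matrix.cons_val_one, Real.dist_eq]
  refine Real.sqrt_le_iff.2 ⟨by positivity, ?_⟩
  nlinarith [abs_nonneg (a - c), abs_nonneg (b - d)]

theorem boundedVariationOn_of_dist_le {E : Type*} [PseudoMetricSpace E] {γ : ℝ → E} {V : ℝ → ℝ}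
    {s : Set ℝ} {A B : ℝ} (hV : ∀ t ∈ s, A ≤ V t ∧ V t ≤ B)
    (hd : ∀ t ∈ s, ∀ t' ∈ s, t ≤ t' → dist (γ t) (γ t') ≤ V t' - V t) :
    BoundedVariationOn γ s := by
  have : eVariationOn γ s ≤ ENNReal.ofReal (B - A) := by
    refine iSup_le fun ⟨n, u, hu, hus⟩ => ?_
    have h1 : ∀ i ∈ Finset.range n, edist (γ (u (i + 1))) (γ (u i)) ≤
        ENNReal.ofReal (V (u (i + 1)) - V (u i)) := by
      intro i _
      rw [edist_dist, dist_comm]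
      exact ENNReal.ofReal_le_ofReal (hd _ (hus i) _ (hus (i + 1)) (hu (Nat.le_succ i)))
    refine (Finset.sum_le_sum h1).trans ?_
    rw [← ENNReal.ofReal_sum_of_nonneg, Finset.sum_range_sub (fun i => V (u i))]
    · exact ENNReal.ofReal_le_ofReal (by linarith [(hV _ (hus n)).2, (hV _ (hus 0)).1])
    · intro i _
      exact dist_nonneg.trans (hd _ (hus i) _ (hus (i + 1)) (hu (Nat.le_succ i)))
  exact (this.trans_lt ENNReal.ofReal_lt_top).ne

namespace IsAmplitude

variable {α τ₀ : ℝ} {p p₁ p₂ p₃ : ℝ → ℝ}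

/-- Both x' and x'' are O(t^(-α)) on the whole half line. The controlling function K t^(1-α)/(1-α)
stays bounded for α > 1, which gives finite length, and grows like t^(1-α) for α < 1, which gives
the upper dimension bound. -/
theorem exists_dist_phasePoint_le (H : IsAmplitude α τ₀ p p₁ p₂ p₃) (hα1 : α ≠ 1) {x : ℝ → ℝ}
    (hx : ∀ t ∈ Ici τ₀, x t = p t * Real.sin t) :
    ∃ K > 0, ∀ t ∈ Ici τ₀, ∀ t' ≥ t, dist (phasePoint x τ₀ t) (phasePoint x τ₀ t') ≤
      K * (t' ^ (1 - α) / (1 - α)) - K * (t ^ (1 - α) / (1 - α)) := by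
  have hα := H.exponent_pos
  have hτ₀ := H.start_pos
  obtain ⟨K₀, hK₀⟩ := exists_forall_abs_le_mul_rpow (α := α) (C := 5 / 4) hτ₀ H.continuousOn (by
    filter_upwards [H.eventually_bounds, eventually_ge_atTop τ₀] with t h ht
    rw [abs_of_pos (H.pos t ht)]
    exact h.2.1)
  obtain ⟨K₁, hK₁⟩ := exists_forall_abs_le_mul_rpow (α := α) (C := 2 * α) hτ₀ H.continuousOn₁ (by
    filter_upwards [H.eventually_bounds, eventually_ge_atTop 1] with t ⟨_, _, h1, h2, _⟩ ht
    have hu : 0 ≤ t ^ (-α) := by positivity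
    have hu' : 0 ≤ t ^ (-α) / t := by positivity
    have h3 : t ^ (-α) / t ≤ t ^ (-α) := div_le_self hu ht
    rw [abs_le]
    constructor <;> nlinarith)
  obtain ⟨K₂, hK₂⟩ := exists_forall_abs_le_mul_rpow (α := α) (C := 2 * α * (α + 1)) hτ₀
    H.continuousOn₂ (by
    filter_upwards [H.eventually_bounds, eventually_ge_atTop 1] with t ⟨_, _, _, _, h⟩ ht
    refine h.trans (mul_le_mul_of_nonneg_left (div_le_self (by positivity) ?_) (by positivity))
    exact one_le_pow₀ ht)
  have hs : ∀ t : ℝ, |Real.sin t| ≤ 1 := Real.abs_sin_le_one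
  have hc : ∀ t : ℝ, |Real.cos t| ≤ 1 := Real.abs_cos_le_one
  have hv : ∀ t ∈ Ici τ₀, |phaseVelocity p p₁ t| ≤ (K₁ + K₀) * t ^ (-α) := by
    intro t ht
    rw [add_mul]
    refine (abs_add_le _ _).trans (add_le_add ?_ ?_)
    · rw [abs_mul]; exact (mul_le_of_le_one_right (abs_nonneg _) (hs t)).trans (hK₁ t ht)
    · rw [abs_mul]; exact (mul_le_of_le_one_right (abs_nonneg _) (hc t)).trans (hK₀ t ht)
  have ha : ∀ t ∈ Ici τ₀, |p₂ t * Real.sin t + 2 * p₁ t * Real.cos t - p t * Real.sin t| ≤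
      (K₂ + 2 * K₁ + K₀) * t ^ (-α) := by
    intro t ht
    rw [add_mul, add_mul]
    refine (abs_sub _ _).trans (add_le_add ((abs_add_le _ _).trans (add_le_add ?_ ?_)) ?_)
    · rw [abs_mul]; exact (mul_le_of_le_one_right (abs_nonneg _) (hs t)).trans (hK₂ t ht)
    · rw [abs_mul]
      refine (mul_le_of_le_one_right (abs_nonneg _) (hc t)).trans ?_
      rw [abs_mul, abs_two, mul_assoc]
      exact mul_le_mul_of_nonneg_left (hK₁ t ht) zero_le_two
    · rw [abs_mul]; exact (mul_le_of_le_one_right (abs_nonneg _) (hs t)).trans (hK₀ t ht)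
  have hnonneg : ∀ {q : ℝ → ℝ} {K : ℝ}, (∀ t ∈ Ici τ₀, |q t| ≤ K * t ^ (-α)) → 0 ≤ K := by
    intro q K h
    exact nonneg_of_mul_nonneg_left ((abs_nonneg _).trans (h τ₀ self_mem_Ici))
      (Real.rpow_pos_of_pos hτ₀ _)
  refine ⟨K₁ + K₀ + (K₂ + 2 * K₁ + K₀), ?_, fun t ht t' htt => ?_⟩
  · have h0 : 0 < K₀ := by
      have := hK₀ τ₀ self_mem_Ici
      exact pos_of_mul_pos_left ((abs_pos.2 (H.pos τ₀ self_mem_Ici).ne').trans_le this)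
        (Real.rpow_nonneg hτ₀.le _)
    linarith [hnonneg hK₁, hnonneg hK₂]
  · have ht' : t' ∈ Ici τ₀ := le_trans ht htt
    rw [H.phasePoint_eq hx ht, H.phasePoint_eq hx ht', dist_comm]
    refine (dist_le_abs_add_abs _ _ _ _).trans ?_
    have h1 := abs_sub_le_of_abs_deriv_le_rpow hα1 hτ₀ (fun s hs => H.hasDerivWithinAt_mul_sin hs)
      hv ht htt
    have h2 := abs_sub_le_of_abs_deriv_le_rpow hα1 hτ₀
      (fun s hs => H.hasDerivWithinAt_phaseVelocity hs) ha ht htt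
    linarith

theorem boundedVariationOn_phasePoint (H : IsAmplitude α τ₀ p p₁ p₂ p₃) (hα1 : 1 < α) {x : ℝ → ℝ}
    (hx : ∀ t ∈ Ici τ₀, x t = p t * Real.sin t) :
    BoundedVariationOn (phasePoint x τ₀) (Ici τ₀) := by
  obtain ⟨K, hK, h⟩ := H.exists_dist_phasePoint_le hα1.ne' hx
  have hτ₀ := H.start_pos
  -- As 1 - α < 0, the controlling function is negative, so it is bounded above by 0; its least
  -- value is at τ₀.
  refine boundedVariationOn_of_dist_le (V := fun t => K * (t ^ (1 - α) / (1 - α)))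
    (A := K * (τ₀ ^ (1 - α) / (1 - α))) (B := 0) (fun t ht => ⟨?_, ?_⟩)
    (fun t ht t' _ htt => h t ht t' htt)
  · exact sub_nonneg.1 (dist_nonneg.trans (h τ₀ self_mem_Ici t ht))
  · have h1 : 0 < t ^ (1 - α) := Real.rpow_pos_of_pos (hτ₀.trans_le ht) _
    exact mul_nonpos_of_nonneg_of_nonpos hK.le
      (div_nonpos_of_nonneg_of_nonpos h1.le (by linarith))

end IsAmplitude

/-! ### Box dimension of the curve -/

/-- The upper content vanishes for s > d and the lower content is positive for s ≤ d, so both sets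
defining the dimensions are exactly (d, ∞). -/
theorem hasBoxDim_of_volume_bounds {N : ℕ} {A : Set (EuclideanSpace ℝ (Fin N))} {d c C : ℝ}
    (hA : Bornology.IsBounded A) (hd : 0 ≤ d) (hc : 0 < c)
    (hlow : ∀ᶠ ε in 𝓝[>] (0 : ℝ),
      ENNReal.ofReal (c * ε ^ ((N : ℝ) - d)) ≤ volume (Metric.thickening ε A))
    (hup : ∀ᶠ ε in 𝓝[>] (0 : ℝ),
      volume (Metric.thickening ε A) ≤ ENNReal.ofReal (C * ε ^ ((N : ℝ) - d))) :
    HasBoxDim A d := by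
  have hzero : ∀ s, d < s → upperMinkowskiContent s A = 0 := by
    intro s hs
    refine Tendsto.limsup_eq ?_
    have hlim : Tendsto (fun ε : ℝ => ENNReal.ofReal (C * ε ^ (s - d))) (𝓝[>] 0) (𝓝 0) := by
      have h1 : Tendsto (fun ε : ℝ => ε ^ (s - d)) (𝓝[>] 0) (𝓝 0) := by
        have h := (Real.continuousAt_rpow_const 0 (s - d) (Or.inr (by linarith))).tendsto
        rw [Real.zero_rpow (by linarith)] at h
        exact h.mono_left nhdsWithin_le_nhds
      have h2 := ENNReal.tendsto_ofReal (h1.const_mul C)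
      simpa using h2
    refine tendsto_of_tendsto_of_tendsto_of_le_of_le' tendsto_const_nhds hlim
      (Eventually.of_forall fun _ => zero_le) ?_
    filter_upwards [hup, self_mem_nhdsWithin] with ε h (hε : 0 < ε)
    have hpos : 0 < ε ^ ((N : ℝ) - s) := Real.rpow_pos_of_pos hε _
    rw [ENNReal.div_le_iff (by simpa using hpos) ENNReal.ofReal_ne_top,
      ← ENNReal.ofReal_mul' hpos.le]
    refine h.trans (le_of_eq ?_)
    rw [mul_assoc, ← Real.rpow_add hε]
    congr 3
    ring
  have hpos : ∀ s ≤ d, lowerMinkowskiContent s A ≠ 0 := by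
    intro s hs
    have h : ENNReal.ofReal c ≤ lowerMinkowskiContent s A := by
      refine le_liminf_of_le (by isBoundedDefault) ?_
      filter_upwards [hlow, Ioo_mem_nhdsGT (zero_lt_one' ℝ)] with ε h hε
      have hpos : 0 < ε ^ ((N : ℝ) - s) := Real.rpow_pos_of_pos hε.1 _
      rw [ENNReal.le_div_iff_mul_le (Or.inl (by simpa using hpos)) (Or.inl ENNReal.ofReal_ne_top),
        ← ENNReal.ofReal_mul hc.le]
      refine le_trans (ENNReal.ofReal_le_ofReal ?_) h
      exact mul_le_mul_of_nonneg_left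
        (Real.rpow_le_rpow_of_exponent_ge hε.1 hε.2.le (by linarith)) hc.le
    exact (lt_of_lt_of_le (by simpa using hc) h).ne'
  have hle : ∀ s, lowerMinkowskiContent s A ≤ upperMinkowskiContent s A := fun s =>
    liminf_le_limsup
  have e1 : {s : ℝ | 0 ≤ s ∧ lowerMinkowskiContent s A = 0} = Ioi d := by
    ext s
    constructor
    · rintro ⟨-, h⟩
      by_contra h'
      exact hpos s (not_lt.1 h') h
    · intro h
      exact ⟨hd.trans (le_of_lt h), le_antisymm ((hle s).trans (hzero s h).le) zero_le⟩
  have e2 : {s : ℝ | 0 ≤ s ∧ upperMinkowskiContent s A = 0} = Ioi d := by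
    ext s
    constructor
    · rintro ⟨-, h⟩
      by_contra h'
      exact hpos s (not_lt.1 h') (le_antisymm ((hle s).trans h.le) zero_le)
    · intro h
      exact ⟨hd.trans (le_of_lt h), hzero s h⟩
  exact ⟨hA, by rw [lowerBoxDim, e1, csInf_Ioi], by rw [upperBoxDim, e2, csInf_Ioi]⟩

theorem volume_ball_eq_ofReal (y : EuclideanSpace ℝ (Fin 2)) {r : ℝ} (hr : 0 ≤ r) :
    volume (Metric.ball y r) = ENNReal.ofReal (Real.pi * r ^ 2) := by
  rw [EuclideanSpace.volume_ball_fin_two, ← ENNReal.ofReal_pow hr,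
    ← ENNReal.ofReal_mul (by positivity), mul_comm]

/-- The area of a neighbourhood of a plane curve whose increments are controlled by those of a
function with values in `[0, L]`. -/
theorem volume_thickening_image_le {S : Set ℝ} {γ : ℝ → EuclideanSpace ℝ (Fin 2)} {V : ℝ → ℝ}
    {L ε : ℝ} (hε : 0 < ε) (hV : ∀ t ∈ S, 0 ≤ V t ∧ V t ≤ L) (hL : 0 ≤ L)
    (hd : ∀ t ∈ S, ∀ t' ∈ S, dist (γ t) (γ t') ≤ |V t - V t'|) :
    volume (Metric.thickening ε (γ '' S)) ≤
      ENNReal.ofReal ((L / ε + 1) * (Real.pi * (2 * ε) ^ 2)) := by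
  -- Parameters are sorted by the value of V in steps of ε. Points of one piece are less than ε
  -- apart, so its neighbourhood lies in a ball of radius 2ε, and at most L/ε + 1 pieces occur.
  set A : ℕ → Set ℝ := fun i => {t ∈ S | ⌊V t / ε⌋₊ = i} with hA
  set n := ⌊L / ε⌋₊ + 1 with hn
  have hcover : Metric.thickening ε (γ '' S) ⊆
      ⋃ i ∈ Finset.range n, Metric.thickening ε (γ '' A i) := by
    intro y hy
    obtain ⟨_, ⟨t, ht, rfl⟩, hyt⟩ := Metric.mem_thickening_iff.1 hy
    refine mem_iUnion₂.2 ⟨⌊V t / ε⌋₊, ?_, Metric.mem_thickening_iff.2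
      ⟨γ t, ⟨t, ⟨ht, rfl⟩, rfl⟩, hyt⟩⟩
    rw [Finset.mem_range, hn]
    exact Nat.lt_succ_of_le (Nat.floor_le_floor (by gcongr; exact (hV t ht).2))
  have hpiece : ∀ i ∈ Finset.range n, volume (Metric.thickening ε (γ '' A i)) ≤
      ENNReal.ofReal (Real.pi * (2 * ε) ^ 2) := by
    intro i _
    rcases (A i).eq_empty_or_nonempty with h | ⟨t, ht⟩
    · simp [h]
    · rw [← volume_ball_eq_ofReal (γ t) (by positivity)]
      refine measure_mono fun y hy => ?_
      obtain ⟨_, ⟨t', ht', rfl⟩, hyt⟩ := Metric.mem_thickening_iff.1 hy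
      have h1 : |V t' / ε - V t / ε| < 1 := by
        have a1 := Nat.floor_le (div_nonneg (hV t ht.1).1 hε.le)
        have a2 := Nat.lt_floor_add_one (V t / ε)
        have b1 := Nat.floor_le (div_nonneg (hV t' ht'.1).1 hε.le)
        have b2 := Nat.lt_floor_add_one (V t' / ε)
        rw [ht.2] at a1 a2
        rw [ht'.2] at b1 b2
        rw [abs_lt]
        constructor <;> linarith
      rw [← sub_div, abs_div, abs_of_pos hε, div_lt_one hε] at h1
      have h2 := hd t' ht'.1 t ht.1
      rw [Metric.mem_ball]
      linarith [dist_triangle y (γ t') (γ t)]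
  calc volume (Metric.thickening ε (γ '' S))
      ≤ ∑ i ∈ Finset.range n, volume (Metric.thickening ε (γ '' A i)) :=
        (measure_mono hcover).trans (measure_biUnion_finset_le _ _)
    _ ≤ ∑ _i ∈ Finset.range n, ENNReal.ofReal (Real.pi * (2 * ε) ^ 2) := Finset.sum_le_sum hpiece
    _ = ENNReal.ofReal (n * (Real.pi * (2 * ε) ^ 2)) := by
        rw [Finset.sum_const, Finset.card_range, nsmul_eq_mul, ENNReal.ofReal_mul (p := (n : ℝ)) (by positivity),
          ENNReal.ofReal_natCast]
    _ ≤ _ := by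
        refine ENNReal.ofReal_le_ofReal (mul_le_mul_of_nonneg_right ?_ (by positivity))
        rw [hn]
        push_cast
        linarith [Nat.floor_le (div_nonneg hL hε.le)]

theorem exists_eq_polarPoint (y : EuclideanSpace ℝ (Fin 2)) : ∃ θ, y = polarPoint ‖y‖ θ := by
  set z : ℂ := ⟨y 0, y 1⟩ with hz
  have hn : ‖z‖ = ‖y‖ := by
    rw [EuclideanSpace.norm_eq, Fin.sum_univ_two, Complex.norm_eq_sqrt_sq_add_sq]
    simp [hz]
  refine ⟨z.arg, ?_⟩
  ext i
  fin_cases i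
  · simp [polarPoint, ← hn, Complex.norm_mul_cos_arg, hz]
  · simp [polarPoint, ← hn, Complex.norm_mul_sin_arg, hz]

theorem dist_polarPoint_same_angle (ρ ρ' θ : ℝ) :
    dist (polarPoint ρ θ) (polarPoint ρ' θ) = |ρ - ρ'| := by
  rw [EuclideanSpace.dist_eq, Fin.sum_univ_two]
  simp only [polarPoint, Matrix.cons_val_zero, Matrix.cons_val_one, Real.dist_eq, sq_abs]
  rw [show (ρ * Real.cos θ - ρ' * Real.cos θ) ^ 2 + (ρ * Real.sin θ - ρ' * Real.sin θ) ^ 2 =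
    (ρ - ρ') ^ 2 by linear_combination ((ρ - ρ') ^ 2) * Real.sin_sq_add_cos_sq θ]
  exact Real.sqrt_sq_eq_abs _

theorem polarPoint_sub_nat_mul (ρ θ : ℝ) (n : ℕ) :
    polarPoint ρ (θ - n * (2 * Real.pi)) = polarPoint ρ θ := by
  simp [polarPoint, Real.cos_sub_nat_mul_two_pi, Real.sin_sub_nat_mul_two_pi]

theorem polarPoint_add_int_mul (ρ θ : ℝ) (n : ℤ) :
    polarPoint ρ (θ + n * (2 * Real.pi)) = polarPoint ρ θ := by
  simp [polarPoint, Real.cos_add_int_mul_two_pi, Real.sin_add_int_mul_two_pi]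

namespace IsAmplitude

variable {α τ₀ : ℝ} {p p₁ p₂ p₃ : ℝ → ℝ}

theorem isBounded_phaseCurve (H : IsAmplitude α τ₀ p p₁ p₂ p₃) {x : ℝ → ℝ}
    (hx : ∀ t ∈ Ici τ₀, x t = p t * Real.sin t) : Bornology.IsBounded (phaseCurve x τ₀) := by
  have hc : ContinuousOn (phaseRadius p p₁) (Ici τ₀) := fun t ht =>
    (H.hasDerivWithinAt_phaseRadius ht).continuousWithinAt
  obtain ⟨T, hT⟩ := eventually_atTop.1 (H.tendsto_phaseRadius.eventually_lt_const one_pos)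
  obtain ⟨K, hK⟩ := isCompact_Icc.exists_bound_of_continuousOn
    (hc.mono (Icc_subset_Ici_self : Icc τ₀ T ⊆ Ici τ₀))
  refine isBounded_iff_forall_norm_le.2 ⟨max K 1, ?_⟩
  rintro _ ⟨t, ht, rfl⟩
  rw [H.phasePoint_eq_polarPoint hx ht, norm_polarPoint (H.phaseRadius_pos ht).le]
  rcases le_total t T with h | h
  · exact (le_abs_self _).trans ((hK t ⟨ht, h⟩).trans (le_max_left _ _))
  · exact (hT t h).le.trans (le_max_right _ _)

/-- The choice T = ε^(-1/(1+α)) balances the two contributions: ε T^(1-α) from the arc up to T and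
T^(-2α) from a disc containing the rest. -/
theorem exists_volume_thickening_le (H : IsAmplitude α τ₀ p p₁ p₂ p₃) (hα1 : α < 1) {x : ℝ → ℝ}
    (hx : ∀ t ∈ Ici τ₀, x t = p t * Real.sin t) :
    ∃ C, ∀ᶠ ε in 𝓝[>] (0 : ℝ), volume (Metric.thickening ε (phaseCurve x τ₀)) ≤
      ENNReal.ofReal (C * ε ^ (2 * α / (1 + α))) := by
  have hα := H.exponent_pos
  have hτ₀ := H.start_pos
  have h1α : 0 < 1 - α := by linarith
  obtain ⟨K, hK, hd⟩ := H.exists_dist_phasePoint_le hα1.ne hx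
  obtain ⟨T₀, hT₀⟩ := eventually_atTop.1 (H.eventually_phaseRadius_bounds.and
    (eventually_ge_atTop τ₀))
  refine ⟨9 * Real.pi + 4 * Real.pi * (K / (1 - α) + 1), ?_⟩
  have htop : Tendsto (fun ε : ℝ => ε ^ (-(1 / (1 + α)))) (𝓝[>] 0) atTop :=
    tendsto_rpow_neg_nhdsGT_zero (neg_neg_of_pos (by positivity))
  filter_upwards [htop.eventually_ge_atTop T₀, Ioo_mem_nhdsGT (zero_lt_one' ℝ)] with ε hT hε
  have hε0 := hε.1
  set T := ε ^ (-(1 / (1 + α))) with hTdef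
  have hTτ : τ₀ ≤ T := (hT₀ T hT).2
  have hT0 : 0 < T := hτ₀.trans_le hTτ
  set δ := ε ^ (2 * α / (1 + α)) with hδ
  have hδ0 : 0 < δ := Real.rpow_pos_of_pos hε0 _
  have e1 : (T ^ (-α)) ^ 2 = δ := by
    rw [hTdef, hδ, ← Real.rpow_natCast, ← Real.rpow_mul hε0.le, ← Real.rpow_mul hε0.le]
    congr 1
    push_cast
    field_simp
  have e2 : ε * T ^ (1 - α) = δ := by
    rw [hTdef, hδ, ← Real.rpow_mul hε0.le]
    nth_rewrite 1 [← Real.rpow_one ε]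
    rw [← Real.rpow_add hε0]
    congr 1
    field_simp
    ring
  -- This absorbs the extra piece in the covering of the arc, and it gives ε ≤ T^(-α), so the
  -- ε-neighbourhood of the disc of radius 2T^(-α) fits in radius 3T^(-α).
  have e3 : ε ^ 2 ≤ δ := by
    rw [hδ, ← Real.rpow_natCast]
    refine Real.rpow_le_rpow_of_exponent_ge hε0 hε.2.le ?_
    rw [div_le_iff₀ (by positivity)]
    push_cast
    linarith
  have e4 : ε ≤ T ^ (-α) := by
    refine (sq_le_sq₀ hε0.le (Real.rpow_nonneg hT0.le _)).1 ?_
    rw [e1]; exact e3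
  have hsub : phaseCurve x τ₀ ⊆
      phasePoint x τ₀ '' Icc τ₀ T ∪ Metric.closedBall 0 (2 * T ^ (-α)) := by
    rintro _ ⟨t, ht, rfl⟩
    rcases le_total t T with h | h
    · exact Or.inl ⟨t, ⟨ht, h⟩, rfl⟩
    · right
      rw [mem_closedBall_zero_iff, H.phasePoint_eq_polarPoint hx ht,
        norm_polarPoint (H.phaseRadius_pos ht).le]
      refine (hT₀ t (hT.trans h)).1.2.trans (mul_le_mul_of_nonneg_left ?_ zero_le_two)
      exact Real.rpow_le_rpow_of_nonpos hT0 h (by linarith)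
  have hmono : ∀ t ∈ Icc τ₀ T, 0 ≤ K * (t ^ (1 - α) / (1 - α)) ∧
      K * (t ^ (1 - α) / (1 - α)) ≤ K * (T ^ (1 - α) / (1 - α)) := by
    intro t ht
    have ht0 : 0 < t := hτ₀.trans_le ht.1
    refine ⟨by positivity, ?_⟩
    have := Real.rpow_le_rpow ht0.le ht.2 h1α.le
    gcongr
  have hpart := volume_thickening_image_le (S := Icc τ₀ T) (γ := phasePoint x τ₀)
    (V := fun t => K * (t ^ (1 - α) / (1 - α))) hε0 hmono (by positivity) (by
      intro t ht t' ht'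
      rcases le_total t t' with h | h
      · rw [abs_sub_comm]
        exact (hd t ht.1 t' h).trans (le_abs_self _)
      · rw [dist_comm]
        exact (hd t' ht'.1 t h).trans (le_abs_self _))
  have hball : Metric.thickening ε (Metric.closedBall (0 : EuclideanSpace ℝ (Fin 2))
      (2 * T ^ (-α))) ⊆ Metric.ball 0 (3 * T ^ (-α)) := by
    intro y hy
    obtain ⟨w, hw, hyw⟩ := Metric.mem_thickening_iff.1 hy
    rw [Metric.mem_closedBall] at hw
    rw [Metric.mem_ball]
    linarith [dist_triangle y w 0]
  calc volume (Metric.thickening ε (phaseCurve x τ₀))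
      ≤ volume (Metric.thickening ε (phasePoint x τ₀ '' Icc τ₀ T) ∪
          Metric.ball 0 (3 * T ^ (-α))) := by
        refine measure_mono ((Metric.thickening_subset_of_subset ε hsub).trans ?_)
        rw [Metric.thickening_union]
        exact union_subset_union_right _ hball
    _ ≤ _ := (measure_union_le _ _).trans (add_le_add hpart le_rfl)
    _ = ENNReal.ofReal ((K * (T ^ (1 - α) / (1 - α)) / ε + 1) * (Real.pi * (2 * ε) ^ 2) +
          Real.pi * (3 * T ^ (-α)) ^ 2) := by
        rw [volume_ball_eq_ofReal _ (by positivity), ENNReal.ofReal_add] <;> positivity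
    _ ≤ _ := by
        refine ENNReal.ofReal_le_ofReal ?_
        have g1 : (K * (T ^ (1 - α) / (1 - α)) / ε + 1) * (Real.pi * (2 * ε) ^ 2) =
            4 * Real.pi * (K / (1 - α) * (ε * T ^ (1 - α)) + ε ^ 2) := by
          field_simp
          ring
        have g2 : Real.pi * (3 * T ^ (-α)) ^ 2 = 9 * Real.pi * (T ^ (-α)) ^ 2 := by ring
        rw [g1, g2, e1, e2]
        have := mul_le_mul_of_nonneg_left e3 (by positivity : 0 ≤ 4 * Real.pi)
        linarith

end IsAmplitude

namespace IsAmplitude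

variable {α τ₀ : ℝ} {p p₁ p₂ p₃ : ℝ → ℝ}

/-- Beyond time `T` the curve crosses every ray, at radii which decrease by less than a
given scale over one turn; hence its neighbourhood of that width contains a disc. -/
theorem ball_subset_thickening_phaseCurve (H : IsAmplitude α τ₀ p p₁ p₂ p₃) {x : ℝ → ℝ}
    (hx : ∀ t ∈ Ici τ₀, x t = p t * Real.sin t) {T R ε : ℝ} (hT : τ₀ ≤ T) (hε : 0 < ε)
    (hangle : ∀ t ≥ T, ∀ t' ≥ t, (t' - t) / 2 ≤ phaseAngle p p₁ t - phaseAngle p p₁ t')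
    (hR : ∀ t ∈ Icc T (T + 4 * Real.pi), R ≤ phaseRadius p p₁ t)
    (hgap : ∀ t ≥ T, ∀ t' ∈ Icc t (t + 4 * Real.pi),
      phaseRadius p p₁ t - phaseRadius p p₁ t' < ε) :
    Metric.ball 0 R ⊆ Metric.thickening ε (phaseCurve x τ₀) := by
  have hpi := Real.pi_pos
  have hsub : Ici T ⊆ Ici τ₀ := Ici_subset_Ici.2 hT
  intro y hy
  rw [mem_ball_zero_iff] at hy
  obtain ⟨θ, hθ⟩ := exists_eq_polarPoint y
  set φ := phaseAngle p p₁ with hφ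
  -- The angle of y is moved into (φ(T) - 2π, φ(T)], so that the first crossing of its ray occurs
  -- within time 4π after T, as the angle has speed at least 1/2.
  obtain ⟨n, ⟨hn1, hn2⟩, -⟩ :=
    existsUnique_add_zsmul_mem_Ioc Real.two_pi_pos θ (φ T - 2 * Real.pi)
  rw [zsmul_eq_mul] at hn1 hn2
  set θ₀ := θ + n * (2 * Real.pi) with hθ₀
  have himage := image_Ici_eq_Iic_of_sub_bounds (H.continuousOn_phaseAngle.mono hsub) hangle
  have hex : ∀ j : ℕ, ∃ t ∈ Ici T, φ t = θ₀ - j * (2 * Real.pi) := by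
    intro j
    have h : θ₀ - j * (2 * Real.pi) ∈ φ '' Ici T := by
      rw [himage]
      have : 0 ≤ (j : ℝ) * (2 * Real.pi) := by positivity
      exact show θ₀ - j * (2 * Real.pi) ≤ φ T by linarith
    exact h
  choose t ht hφt using hex
  have horder : ∀ s ∈ Ici T, ∀ s' ∈ Ici T, φ s' ≤ φ s → s ≤ s' := by
    intro s _ s' hs' h
    by_contra! hlt
    have := hangle s' hs' s hlt.le
    linarith
  have hstep : ∀ j, t (j + 1) ∈ Icc (t j) (t j + 4 * Real.pi) := by
    intro j
    have e : φ (t (j + 1)) = φ (t j) - 2 * Real.pi := by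
      rw [hφt, hφt]; push_cast; ring
    have h1 := horder _ (ht j) _ (ht (j + 1)) (by linarith)
    have h2 := hangle _ (ht j) _ h1
    exact ⟨h1, by linarith⟩
  have hlim : Tendsto t atTop atTop := by
    refine tendsto_atTop_mono (f := fun j : ℕ => (j : ℝ) * (2 * Real.pi) - (θ₀ + 2 * Real.pi)) ?_ ?_
    · intro j
      have h1 := (abs_le.1 (abs_phaseAngle_add_le p p₁ (t j))).1
      rw [← hφ, hφt] at h1
      linarith
    · exact tendsto_atTop_add_const_right _ _
        (tendsto_natCast_atTop_atTop.atTop_mul_const (by positivity))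
  have hpoint : ∀ j, phasePoint x τ₀ (t j) = polarPoint (phaseRadius p p₁ (t j)) θ := by
    intro j
    rw [H.phasePoint_eq_polarPoint hx (hsub (ht j)), ← hφ, hφt, polarPoint_sub_nat_mul, hθ₀,
      polarPoint_add_int_mul]
  suffices h : ∃ j, |‖y‖ - phaseRadius p p₁ (t j)| < ε by
    obtain ⟨j, hj⟩ := h
    refine Metric.mem_thickening_iff.2 ⟨phasePoint x τ₀ (t j), ⟨t j, hsub (ht j), rfl⟩, ?_⟩
    rw [hpoint, hθ, dist_polarPoint_same_angle]
    exact hj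
  have hrad := H.tendsto_phaseRadius.comp hlim
  -- The origin is treated apart, since no crossing has radius at most 0. For y ≠ 0 take the first
  -- crossing with radius at most ‖y‖: it is not the initial one, whose radius is at least R, and
  -- the preceding crossing is farther out than y by minimality. So y lies between two crossings
  -- less than ε apart.
  rcases (norm_nonneg y).eq_or_lt with h0 | h0
  · obtain ⟨j, hj⟩ := (hrad.eventually_lt_const hε).exists
    refine ⟨j, ?_⟩
    rw [← h0, zero_sub, abs_neg, abs_of_pos (H.phaseRadius_pos (hsub (ht j)))]
    exact hj
  · have hex : ∃ j, phaseRadius p p₁ (t j) ≤ ‖y‖ :=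
      (hrad.eventually_lt_const h0).exists.imp fun j hj => hj.le
    classical
    have hspec := Nat.find_spec hex
    cases hj : Nat.find hex with
    | zero =>
      rw [hj] at hspec
      have h1 : t 0 ≤ T + 4 * Real.pi := by
        have h2 := hangle T le_rfl (t 0) (ht 0)
        have h3 : φ (t 0) = θ₀ := by rw [hφt]; simp
        rw [h3] at h2
        linarith
      exact absurd (hR _ ⟨ht 0, h1⟩) (by linarith)
    | succ j =>
      rw [hj] at hspec
      have h1 := not_le.1 (Nat.find_min hex (m := j) (by omega))
      have h2 := hgap _ (ht j) _ (hstep j)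
      refine ⟨j + 1, ?_⟩
      rw [abs_of_nonneg (by linarith)]
      linarith

/-- A filled disc suffices. With T^(-α-1) = ε/B and B = 8πC, the loss of radius over time 4π is at
most 4πC ε/B = ε/2, so the disc of radius (2T)^(-α)/2 is filled, and its area has order T^(-2α). -/
theorem exists_le_volume_thickening (H : IsAmplitude α τ₀ p p₁ p₂ p₃) {x : ℝ → ℝ}
    (hx : ∀ t ∈ Ici τ₀, x t = p t * Real.sin t) :
    ∃ c > 0, ∀ᶠ ε in 𝓝[>] (0 : ℝ), ENNReal.ofReal (c * ε ^ (2 * α / (1 + α))) ≤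
      volume (Metric.thickening ε (phaseCurve x τ₀)) := by
  have hα := H.exponent_pos
  have hτ₀ := H.start_pos
  have hpi := Real.pi_pos
  obtain ⟨T₁, hT₁⟩ := H.exists_phaseAngle_sub_bounds
  obtain ⟨_, _, C, hC, hb⟩ := H.exists_phaseRadiusDeriv_bounds
  obtain ⟨T₂, hT₂⟩ := eventually_atTop.1 (hb.and H.eventually_phaseRadius_bounds)
  set B := 8 * Real.pi * C with hB
  have hB0 : 0 < B := by positivity
  refine ⟨Real.pi * (2 ^ (-α) / 2) ^ 2 * B⁻¹ ^ (2 * α / (1 + α)), by positivity, ?_⟩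
  have htop : Tendsto (fun ε : ℝ => (ε * B⁻¹) ^ (-(1 / (1 + α)))) (𝓝[>] 0) atTop := by
    refine (tendsto_rpow_neg_nhdsGT_zero (neg_neg_of_pos (by positivity))).comp ?_
    refine tendsto_nhdsWithin_iff.2 ⟨?_, ?_⟩
    · have : Tendsto (fun ε : ℝ => ε * B⁻¹) (𝓝 0) (𝓝 (0 * B⁻¹)) := tendsto_id.mul_const _
      rw [zero_mul] at this
      exact this.mono_left nhdsWithin_le_nhds
    · filter_upwards [self_mem_nhdsWithin] with ε (hε : 0 < ε)
      exact mul_pos hε (inv_pos.2 hB0)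
  -- The requirement T ≥ 4π gives T + 4π ≤ 2T, which is why the radius is bounded below through 2T.
  filter_upwards [htop.eventually_ge_atTop (max (max T₁ T₂) (max (τ₀ + 1) (4 * Real.pi))),
    self_mem_nhdsWithin] with ε hT (hε : 0 < ε)
  set T := (ε * B⁻¹) ^ (-(1 / (1 + α))) with hTdef
  have hTT₁ : T₁ ≤ T := ((le_max_left _ _).trans (le_max_left _ _)).trans hT
  have hTT₂ : T₂ ≤ T := ((le_max_right _ _).trans (le_max_left _ _)).trans hT
  have hTτ : τ₀ + 1 ≤ T := ((le_max_left _ _).trans (le_max_right _ _)).trans hT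
  have hTpi : 4 * Real.pi ≤ T := ((le_max_right _ _).trans (le_max_right _ _)).trans hT
  have hT0 : 0 < T := by linarith
  have hη : 0 < ε * B⁻¹ := by positivity
  have e1 : (T ^ (-α)) ^ 2 = ε ^ (2 * α / (1 + α)) * B⁻¹ ^ (2 * α / (1 + α)) := by
    rw [← Real.mul_rpow hε.le (by positivity), hTdef, ← Real.rpow_natCast, ← Real.rpow_mul hη.le,
      ← Real.rpow_mul hη.le]
    congr 1
    push_cast
    field_simp
  have e2 : T ^ (-α) / T = ε * B⁻¹ := by
    rw [← Real.rpow_sub_one hT0.ne', hTdef, ← Real.rpow_mul hη.le]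
    nth_rewrite 2 [← Real.rpow_one (ε * B⁻¹)]
    congr 1
    field_simp
    ring
  have hderiv : ∀ s ≥ T, -(C * (ε * B⁻¹)) ≤ phaseRadiusDeriv p p₁ p₂ s := by
    intro s hs
    have h1 := (abs_le.1 (hT₂ s (hTT₂.trans hs)).1.2).1
    have hs0 : 0 < s := hT0.trans_le hs
    have h2 : s ^ (-α) / s ≤ ε * B⁻¹ := by
      rw [← e2, ← Real.rpow_sub_one hT0.ne', ← Real.rpow_sub_one hs0.ne']
      exact Real.rpow_le_rpow_of_nonpos hT0 hs (by linarith)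
    have h3 := mul_le_mul_of_nonneg_left h2 hC.le
    linarith
  have hball := H.ball_subset_thickening_phaseCurve hx (T := T) (R := (2 * T) ^ (-α) / 2)
    (ε := ε) (by linarith) hε (fun t ht t' ht' => (hT₁ t (hTT₁.trans ht) t' ht').1) (by
      intro t ht
      refine le_trans ?_ (hT₂ t (hTT₂.trans ht.1)).2.1
      have ht0 : 0 < t := hT0.trans_le ht.1
      have := Real.rpow_le_rpow_of_nonpos ht0 (by linarith [ht.2] : t ≤ 2 * T)
        (by linarith : -α ≤ 0)
      linarith) (by
      intro t ht t' ht'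
      have hder : ∀ s ∈ Icc t t', HasDerivAt (phaseRadius p p₁) (phaseRadiusDeriv p p₁ p₂ s) s :=
        fun s hs => H.hasDerivAt_phaseRadius (by linarith [hs.1])
      have h1 := (convex_Icc t t').mul_sub_le_image_sub_of_le_deriv
        (fun s hs => (hder s hs).continuousAt.continuousWithinAt)
        (fun s hs => (hder s (interior_subset hs)).differentiableAt.differentiableWithinAt)
        (C := -(C * (ε * B⁻¹))) (fun s hs => by
          rw [(hder s (interior_subset hs)).deriv]
          exact hderiv s (ht.le.trans (interior_subset hs).1))
        t (left_mem_Icc.2 ht'.1) t' (right_mem_Icc.2 ht'.1) ht'.1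
      have h2 : C * (ε * B⁻¹) * (t' - t) ≤ C * (ε * B⁻¹) * (4 * Real.pi) :=
        mul_le_mul_of_nonneg_left (by linarith [ht'.2]) (by positivity)
      have h3 : C * (ε * B⁻¹) * (4 * Real.pi) = ε / 2 := by
        rw [hB]; field_simp; norm_num
      linarith)
  refine le_trans (le_of_eq ?_) (measure_mono hball)
  rw [volume_ball_eq_ofReal _ (by positivity), Real.mul_rpow (by norm_num) hT0.le]
  congr 1
  rw [show Real.pi * (2 ^ (-α) * T ^ (-α) / 2) ^ 2 =
    Real.pi * (2 ^ (-α) / 2) ^ 2 * (T ^ (-α)) ^ 2 by ring, e1]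
  ring

theorem hasPhaseDim (H : IsAmplitude α τ₀ p p₁ p₂ p₃) (hα1 : α < 1) {x : ℝ → ℝ}
    (hx : ∀ t ∈ Ici τ₀, x t = p t * Real.sin t) : HasPhaseDim x τ₀ (2 / (1 + α)) := by
  have hα := H.exponent_pos
  obtain ⟨C, hC⟩ := H.exists_volume_thickening_le hα1 hx
  obtain ⟨c, hc, hc'⟩ := H.exists_le_volume_thickening hx
  have e : ((2 : ℕ) : ℝ) - 2 / (1 + α) = 2 * α / (1 + α) := by
    push_cast; field_simp; ring
  refine hasBoxDim_of_volume_bounds (c := c) (C := C) (H.isBounded_phaseCurve hx) (by positivity)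
    hc ?_ ?_
  · rw [e]; exact hc'
  · rw [e]; exact hC

end IsAmplitude

theorem theorem4 (α τ₀ : ℝ) (hα : 0 < α) (hτ₀ : 0 < τ₀) (P X x : ℝ → ℝ)
    (hP_smooth : ContDiffOn ℝ 3 P (Ioc 0 (1 / τ₀)))
    (hP_pos : ∀ τ ∈ Ioc 0 (1 / τ₀), 0 < P τ)
    (hP : EquivalentUpTo 3 (𝓝[>] 0) P (fun τ => τ ^ α))
    (hX : ∀ τ ∈ Ioc 0 (1 / τ₀), X τ = P τ * Real.sin (1 / τ))
    (hx : ∀ t ∈ Ici τ₀, x t = X (1 / t)) :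
    (∃ φ : ℝ → ℝ, IsPhaseAngle x τ₀ φ) ∧
    ∀ φ : ℝ → ℝ, IsPhaseAngle x τ₀ φ →
      (α < 1 →
        (∃ (f : ℝ → ℝ) (φ₀ : ℝ), IsWavySpiralNearOrigin x τ₀ φ f φ₀ ∧
          Comparable atBot f (fun θ => |θ| ^ (-α))) ∧
        HasPhaseDim x τ₀ (2 / (1 + α))) ∧
      (1 < α →
        (∃ (f : ℝ → ℝ) (φ₀ : ℝ), IsWavySpiralNearOrigin x τ₀ φ f φ₀) ∧
        BoundedVariationOn (phasePoint x τ₀) (Ici τ₀)) := by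
  obtain ⟨p₁, p₂, p₃, H⟩ := exists_isAmplitude hα hτ₀ hP_smooth hP_pos hP
  have hx' : ∀ t ∈ Ici τ₀, x t = P t⁻¹ * Real.sin t := by
    intro t ht
    have ht0 : 0 < t := hτ₀.trans_le ht
    rw [hx t ht, hX _ ⟨by positivity, one_div_le_one_div_of_le hτ₀ ht⟩, one_div, one_div, inv_inv]
  refine ⟨⟨_, H.isPhaseAngle_phaseAngle hx'⟩, fun φ hφ => ⟨fun h => ?_, fun h => ?_⟩⟩
  · exact ⟨H.exists_wavySpiral h.ne hx' hφ, H.hasPhaseDim h hx'⟩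
  · obtain ⟨f, φ₀, hf, -⟩ := H.exists_wavySpiral h.ne' hx' hφ
    exact ⟨⟨f, φ₀, hf⟩, H.boundedVariationOn_phasePoint h hx'⟩
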